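/- **Setting.** Let $\mathcal A$ be a finite set of actions and $\Theta$ a finite set of parameters. Let $\mathcal Y$ be the outcome space (a measurable space with countably generated $\sigma$-algebra; the underlying probability space is standard Borel). Let $g:\mathcal A\times\Theta\times\mathcal W\to\mathcal Y$ be a known system function, $\nu$ a probability law of the noise on $\mathcal W$, and $R:\mathcal Y\to\mathbb R$ a reward function with $\sup_y R(y)-\inf_y R(y)\le 1$. The true parameter $\theta^*$ is a $\Theta$-valued random variable. In each period $t=1,2,\dots$ a noise $W_t\sim\nu$ is drawn, and playing the action $a$ gives the outcome $Y_{t,a}=g(a,\theta^*,W_t)$. Put $\mu(a,\theta)=\mathbb E_{W\sim\nu}[R(g(a,\theta,W))]$, let $\alpha(\theta)\in\arg\max_a\mu(a,\theta)$, and let $R^*=\mu(\alpha(\theta^*),\theta^*)$. Thompson sampling draws in period $t$ a parameter $\theta_t$ from the posterior law of $\theta^*$ given the history $\mathcal H_{t-1}=(\theta_s,Y_{s,\alpha(\theta_s)})_{s<t}$, conditionally independently of $\theta^*$ given $\mathcal H_{t-1}$, and plays $\alpha(\theta_t)$; the noise $W_t$ is independent of $(\theta^*,\mathcal H_{t-1},\theta_t)$.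 Its Bayesian regret is $\mathrm{BayesRegret}(T;\pi^{\mathrm{TS}})=\mathbb E\big[\sum_{t=1}^T (R^*-R(Y_{t,\alpha(\theta_t)}))\big]$. Let $\mathbb P_{t-1}=\mathbb P(\cdot\mid\mathcal H_{t-1})$, let $\mathbb E_{t-1}$ and $I_{t-1}$ be expectation and mutual information under $\mathbb P_{t-1}$, and let $I(X;Z\mid \mathcal H_{t-1})=\mathbb E[I_{t-1}(X;Z)]$. For $\Theta$-valued random variables $\vartheta,\vartheta'$ the information ratio in period $t$ is $$\Gamma_t(\vartheta;\vartheta')=\frac{\big(\mathbb E[R(Y_{t,\alpha(\vartheta)})-R(Y_{t,\alpha(\vartheta')})]\big)^2}{I\big(\vartheta;(\vartheta',Y_{t,\alpha(\vartheta')})\mid\mathcal H_{t-1}\big)}\qquad(0/0:=0).$$ **Theorem.** Let $d(\theta,\theta')=\mu(\alpha(\theta'),\theta')-\mu(\alpha(\theta),\theta')$, let $\{\Theta_k\}_{k=1}^K$ be any partition of $\Theta$ with $d(\theta,\theta')\le\epsilon$ for all $k$ and all $\theta,\theta'\in\Theta_k$, and let $\psi$ be the index of the cell that contains $\theta^*$.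 Call a pair $(\tilde\theta^*_t,\tilde\theta_t)$ of $\Theta$-valued random variables a *compressed Thompson sampling step* in period $t$ if $W_t$ is independent of $(\theta^*,\mathcal H_{t-1},\tilde\theta^*_t,\tilde\theta_t)$ and, almost surely, 1. under $\mathbb P_{t-1}$, $\tilde\theta^*_t$ is independent of $\theta^*$ conditionally on $\psi$; 2. under $\mathbb P_{t-1}$, $\tilde\theta_t$ is distributed as $\tilde\theta^*_t$ and is independent of $(\tilde\theta^*_t,\theta^*)$; 3. $\mathbb E_{t-1}[R^*-R(Y_{t,\alpha(\theta_t)})]-\mathbb E_{t-1}[R(Y_{t,\alpha(\tilde\theta^*_t)})-R(Y_{t,\alpha(\tilde\theta_t)})]\le\epsilon$; 4. $I_{t-1}(\psi;(\tilde\theta_t,Y_{t,\alpha(\tilde\theta_t)}))\le I_{t-1}(\psi;(\theta_t,Y_{t,\alpha(\theta_t)}))$. Then, possibly after enlarging the probability space, compressed Thompson sampling steps $(\tilde\theta^*_t,\tilde\theta_t)$ exist for all $t$; and for every choice of such steps and every $T$, $$\mathrm{BayesRegret}(T;\pi^{\mathrm{TS}})\le\sqrt{\overline\Gamma\cdot I(\theta^*;\psi)\cdot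 T}+\epsilon T,\qquad \overline\Gamma=\max_{1\le t\le T}\Gamma_t(\tilde\theta^*_t;\tilde\theta_t).$$ -/

import Mathlib

open MeasureTheory ProbabilityTheory InformationTheory
open scoped ENNReal

universe u

noncomputable section

/-- Mutual information `I(X; Z)` (in nats) of two random variables under the measure `P`: the
Kullback-Leibler divergence of the joint law from the product of the marginals. -/
def mutualInfo {Ω E F : Type*} [MeasurableSpace Ω] [MeasurableSpace E] [MeasurableSpace F]
    (P : Measure Ω) (X : Ω → E) (Z : Ω → F) : ℝ≥0∞ :=
  klDiv (P.map fun ω => (X ω, Z ω)) ((P.map X).prod (P.map Z))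

/-- An online decision problem with actions `A`, parameters `Θ`, noise values `𝒲` and outcomes `Y`:
the system function `g`, the law `ν` of the exogenous noise, and a reward function `R` with
`sup R - inf R ≤ 1`. -/
structure Bandit (A Θ 𝒲 Y : Type*) [MeasurableSpace 𝒲] [MeasurableSpace Y] where
  g : A → Θ → 𝒲 → Y
  ν : Measure 𝒲
  R : Y → ℝ
  measurable_g : ∀ a θ, Measurable (g a θ)
  isProbabilityMeasure_ν : IsProbabilityMeasure ν
  measurable_R : Measurable R
  R_range : ∀ y y', R y - R y' ≤ 1

/-- The random variables of a run: the true parameter `θstar`, and for every period `t = 0, 1, 2, …`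
the exogenous noise `W t` and the parameter `θ t` sampled by the agent. -/
structure Run (Θ 𝒲 Ω : Type*) where
  θstar : Ω → Θ
  W : ℕ → Ω → 𝒲
  θ : ℕ → Ω → Θ

/-- The same random variables, seen on an extension `φ : Ω' → Ω` of the sample space. -/
def Run.lift {Θ 𝒲 Ω Ω' : Type*} (X : Run Θ 𝒲 Ω) (φ : Ω' → Ω) : Run Θ 𝒲 Ω' where
  θstar := X.θstar ∘ φ
  W := fun t => X.W t ∘ φ
  θ := fun t => X.θ t ∘ φ

namespace Bandit

variable {A Θ 𝒲 Y Ω : Type*} [MeasurableSpace Θ] [MeasurableSpace 𝒲] [MeasurableSpace Y]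
  [MeasurableSpace Ω]

/-- `μ(a, θ)`, the expected reward of action `a` when the true parameter is `θ`. -/
def mean (B : Bandit A Θ 𝒲 Y) (a : A) (θ : Θ) : ℝ :=
  ∫ w, B.R (B.g a θ w) ∂B.ν

/-- `α(θ)` is, for every `θ`, a maximizer of `a ↦ μ(a, θ)`. -/
def IsOptimal (B : Bandit A Θ 𝒲 Y) (α : Θ → A) : Prop :=
  ∀ θ a, B.mean a θ ≤ B.mean (α θ) θ

/-- The distortion `d(θ, θ') = μ(α(θ'), θ') - μ(α(θ), θ')`. -/
def distortion (B : Bandit A Θ 𝒲 Y) (α : Θ → A) (θ θ' : Θ) : ℝ :=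
  B.mean (α θ') θ' - B.mean (α θ) θ'

/-- The outcome `Y_{α(ϑ)}` in period `t` if the action `α(ϑ)` is played. -/
def outcome (B : Bandit A Θ 𝒲 Y) (α : Θ → A) (X : Run Θ 𝒲 Ω) (t : ℕ) (ϑ : Ω → Θ) (ω : Ω) : Y :=
  B.g (α (ϑ ω)) (X.θstar ω) (X.W t ω)

/-- The history before period `t`: sampled parameters and outcomes of the periods `0, …, t - 1`. -/
def history (B : Bandit A Θ 𝒲 Y) (α : Θ → A) (X : Run Θ 𝒲 Ω) (t : ℕ) (ω : Ω) : Fin t → Θ × Y :=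
  fun s => (X.θ s ω, B.outcome α X s (X.θ s) ω)

/-- The regular conditional probability on `Ω` given the history before period `t`. -/
def posterior (B : Bandit A Θ 𝒲 Y) (α : Θ → A) (P : Measure Ω) [IsFiniteMeasure P]
    [StandardBorelSpace Ω] (X : Run Θ 𝒲 Ω) (t : ℕ) (ω : Ω) : Measure Ω :=
  condExpKernel P (MeasurableSpace.comap (B.history α X t) inferInstance) ω

/-- The conditional mutual information of two random variables given the history before
period `t`: the mean of their mutual information under the posterior. -/
def condMutualInfo {E F : Type*} [MeasurableSpace E] [MeasurableSpace F]
    (B : Bandit A Θ 𝒲 Y) (α : Θ → A) (P : Measure Ω) [IsFiniteMeasure P]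
    [StandardBorelSpace Ω] (X : Run Θ 𝒲 Ω) (t : ℕ) (U : Ω → E) (V : Ω → F) : ℝ≥0∞ :=
  ∫⁻ ω, mutualInfo (B.posterior α P X t ω) U V ∂P

/-- The information ratio `Γ_t(ϑ; ϑ')`. -/
def infoRatio (B : Bandit A Θ 𝒲 Y) (α : Θ → A) (P : Measure Ω) [IsFiniteMeasure P]
    [StandardBorelSpace Ω] (X : Run Θ 𝒲 Ω) (t : ℕ) (ϑ ϑ' : Ω → Θ) : ℝ :=
  (∫ ω, (B.R (B.outcome α X t ϑ ω) - B.R (B.outcome α X t ϑ' ω)) ∂P) ^ 2 /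
    (B.condMutualInfo α P X t ϑ (fun ω => (ϑ' ω, B.outcome α X t ϑ' ω))).toReal

/-- The maximal mean reward `R* = μ(α(θ*), θ*)`. -/
def bestReward (B : Bandit A Θ 𝒲 Y) (α : Θ → A) (X : Run Θ 𝒲 Ω) (ω : Ω) : ℝ :=
  B.mean (α (X.θstar ω)) (X.θstar ω)

/-- The Bayesian regret over `T` periods when `α(θ t)` is played in period `t`. -/
def bayesRegret (B : Bandit A Θ 𝒲 Y) (α : Θ → A) (P : Measure Ω) (X : Run Θ 𝒲 Ω) (T : ℕ) : ℝ :=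
  ∫ ω, ∑ t ∈ Finset.range T, (B.bestReward α X ω - B.R (B.outcome α X t (X.θ t) ω)) ∂P

/-- `X` is a run of Thompson sampling: in every period the noise has law `ν` and is independent of
the true parameter, the past and the agent's choice, and given the history the agent's `θ t` is a
sample from the posterior law of `θstar`, drawn independently of `θstar`. -/
structure IsThompsonSampling (B : Bandit A Θ 𝒲 Y) (α : Θ → A) (P : Measure Ω)
    [IsFiniteMeasure P] [StandardBorelSpace Ω] (X : Run Θ 𝒲 Ω) : Prop where
  measurable_θstar : Measurable X.θstar
  measurable_W : ∀ t, Measurable (X.W t)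
  measurable_θ : ∀ t, Measurable (X.θ t)
  noise_law : ∀ t, P.map (X.W t) = B.ν
  noise_indep : ∀ t, IndepFun (X.W t) (fun ω => (X.θstar ω, B.history α X t ω, X.θ t ω)) P
  sample_law : ∀ t, ∀ᵐ ω ∂P,
    (B.posterior α P X t ω).map (X.θ t) = (B.posterior α P X t ω).map X.θstar
  sample_indep : ∀ t, ∀ᵐ ω ∂P, IndepFun (X.θ t) X.θstar (B.posterior α P X t ω)

/-- One-step compressed Thompson sampling in period `t` with respect to the statistic `ψ` and the
tolerance `ε`: a target `τstar` and a sample `τ`. -/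
structure IsCompressed {K : ℕ} (B : Bandit A Θ 𝒲 Y) (α : Θ → A) (P : Measure Ω)
    [IsFiniteMeasure P] [StandardBorelSpace Ω] (X : Run Θ 𝒲 Ω) (ψ : Ω → Fin K) (ε : ℝ) (t : ℕ)
    (τstar τ : Ω → Θ) : Prop where
  measurable_target : Measurable τstar
  measurable_sample : Measurable τ
  /-- The noise of period `t` is independent of the past and of the draws of `τstar` and `τ`. -/
  noise_indep :
    IndepFun (X.W t) (fun ω => (X.θstar ω, B.history α X t ω, τstar ω, τ ω)) P
  /-- Given the history, `τstar` is independent of `θstar` conditionally on `ψ`. -/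
  target_indep : ∀ᵐ ω ∂P, ∀ k,
    IndepFun τstar X.θstar (ProbabilityTheory.cond (B.posterior α P X t ω) (ψ ⁻¹' {k}))
  /-- Given the history, `τ` is distributed as `τstar` … -/
  sample_law : ∀ᵐ ω ∂P,
    (B.posterior α P X t ω).map τ = (B.posterior α P X t ω).map τstar
  /-- … and drawn independently of `τstar` and of the true parameter. -/
  sample_indep : ∀ᵐ ω ∂P,
    IndepFun τ (fun ω' => (τstar ω', X.θstar ω')) (B.posterior α P X t ω)
  /-- The posterior expected regret of Thompson sampling exceeds that of the compressed step by
  at most `ε`. -/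
  regret_le : ∀ᵐ ω ∂P,
    (∫ ω', (B.bestReward α X ω' - B.R (B.outcome α X t (X.θ t) ω')) ∂(B.posterior α P X t ω))
      - (∫ ω', (B.R (B.outcome α X t τstar ω') - B.R (B.outcome α X t τ ω'))
          ∂(B.posterior α P X t ω)) ≤ ε
  /-- The compressed step reveals no more information on `ψ` than Thompson sampling. -/
  info_le : ∀ᵐ ω ∂P,
    mutualInfo (B.posterior α P X t ω) ψ (fun ω' => (τ ω', B.outcome α X t τ ω')) ≤
      mutualInfo (B.posterior α P X t ω) ψ (fun ω' => (X.θ t ω', B.outcome α X t (X.θ t) ω'))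

end Bandit

end

/-! ### Posterior kernels: characterization, tower property, independence -/

section CondExpKernel

/-! Regret bound. By condition 3, period `t` costs at most `Δ t + ε`, where `Δ t` is the expected
reward gap between target and sample. By definition of the ratio, `Δ t ^ 2` equals the information
ratio times the conditional information between the target and the sample with its outcome. Given
the history, the target depends on the true parameter only through `ψ`, while sample and noise are
independent of the target and the parameter jointly. So data processing (`mutualInfo_target_le`)
replaces the target by `ψ`, and condition 4 replaces the compressed sample by that of Thompson
sampling. What Thompson sampling reveals about `ψ` is at most the drop of the conditional entropy of
`ψ` (`lintegral_mutualInfo_le_condEntropy_sub`). These drops telescope to at most the entropy of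
`ψ`, which is at most `I(θ*; ψ)`. Cauchy–Schwarz over the periods gives the square root.

A vanishing denominator needs its own argument: if the sample with its outcome is independent of the
target, the gap is zero (`integral_sub_eq_zero_of_mutualInfo_eq_zero`).

Existence. With an independent uniform variable adjoined, let the target be a fresh draw from the
law of the true parameter given `ψ` and the history, and let the sample be that of Thompson
sampling. Condition 4 is then an equality. In condition 3 the rewards of the samples cancel and an
average distortion between target and true parameter remains; the two lie in the same cell almost
surely, so it is at most `ε` (`isCompressed_resample`).

The technical burden is that posteriors are kernels, whose identities hold almost surely for each
event. Countable generation of the outcome σ-algebra, or finiteness of the parameters, makes them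
hold for all relevant events at once. -/

theorem ProbabilityTheory.Kernel.ae_eq_of_forall_measurableSet {α β : Type*} [MeasurableSpace α]
    [MeasurableSpace β] [MeasurableSpace.CountablyGenerated β] {μ : Measure α} [IsFiniteMeasure μ]
    {κ η : Kernel α β} [IsFiniteKernel κ] [IsFiniteKernel η]
    (h : ∀ B, MeasurableSet B → ∀ᵐ a ∂μ, κ a B = η a B) : ∀ᵐ a ∂μ, κ a = η a := by
  -- The null set in `h` depends on `B`. The measure `μ ⊗ₘ κ` is determined by rectangles, each of
  -- which involves a single null set.
  refine (Kernel.compProd_eq_iff (μ := μ) (κ := κ) (η := η)).1 ?_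
  refine Measure.ext_prod fun {s t} hs ht => ?_
  rw [Measure.compProd_apply_prod hs ht, Measure.compProd_apply_prod hs ht]
  exact lintegral_congr_ae (ae_restrict_of_ae (h t ht))

variable {Ω : Type*} {m m₁ m₂ : MeasurableSpace Ω} [mΩ : MeasurableSpace Ω]
  [StandardBorelSpace Ω] {P : Measure Ω} [IsFiniteMeasure P]

/-- The composition of `P`, trimmed to `m`, with the kernel is the image of `P` under the diagonal;
integrate the second coordinate over `A × Ω`. -/
theorem setLIntegral_lintegral_condExpKernel (hm : m ≤ mΩ) {f : Ω → ℝ≥0∞} (hf : Measurable f)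
    {A : Set Ω} (hA : MeasurableSet[m] A) :
    ∫⁻ ω in A, ∫⁻ ω', f ω' ∂(condExpKernel P m ω) ∂P = ∫⁻ ω in A, f ω ∂P := by
  have h := compProd_trim_condExpKernel (μ := P) hm
  have hF : Measurable[m] fun ω => ∫⁻ ω', f ω' ∂(condExpKernel P m ω) := hf.lintegral_kernel
  have hd : @Measurable Ω (Ω × Ω) mΩ (m.prod mΩ) Function.diag :=
    Measurable.prodMk (measurable_id'' hm) measurable_id
  have h1 : ∫⁻ ω in A, ∫⁻ ω', f ω' ∂(condExpKernel P m ω) ∂P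
      = ∫⁻ ω in A, ∫⁻ ω', f ω' ∂(condExpKernel P m ω) ∂(P.trim hm) := by
    rw [restrict_trim hm P hA, lintegral_trim hm hF]
  have hf2 : @Measurable (Ω × Ω) ℝ≥0∞ (m.prod mΩ) _ fun x => f x.2 :=
    hf.comp (@measurable_snd Ω Ω m mΩ)
  have hS : @MeasurableSet (Ω × Ω) (m.prod mΩ) (A ×ˢ Set.univ) :=
    @MeasurableSet.prod Ω Ω m mΩ _ _ hA MeasurableSet.univ
  rw [h1]
  have h2 := @Measure.setLIntegral_compProd Ω Ω m mΩ (P.trim hm) (condExpKernel P m) _ _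
    (fun x => f x.2) hf2 A hA Set.univ MeasurableSet.univ
  simp only [Measure.restrict_univ] at h2
  rw [← h2, h, @setLIntegral_map Ω (Ω × Ω) mΩ (m.prod mΩ) P _ _ _ hS hf2 hd]
  simp [Function.diag, Set.preimage]

theorem setLIntegral_condExpKernel (hm : m ≤ mΩ) {s : Set Ω} (hs : MeasurableSet s)
    {A : Set Ω} (hA : MeasurableSet[m] A) :
    ∫⁻ ω in A, condExpKernel P m ω s ∂P = P (s ∩ A) := by
  have := setLIntegral_lintegral_condExpKernel (P := P) hm
    (measurable_const.indicator hs : Measurable (s.indicator fun _ => (1 : ℝ≥0∞))) hA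
  simpa [lintegral_indicator hs, hs] using this

/-- The basic tool for identifying posterior probabilities: an `m`-measurable candidate need only
have the right integrals over `m`-measurable sets. -/
theorem condExpKernel_apply_ae_eq (hm : m ≤ mΩ) {s : Set Ω} (hs : MeasurableSet s)
    {f : Ω → ℝ≥0∞} (hf : Measurable[m] f)
    (h : ∀ A, MeasurableSet[m] A → ∫⁻ ω in A, f ω ∂P = P (s ∩ A)) :
    ∀ᵐ ω ∂P, condExpKernel P m ω s = f ω := by
  refine ae_eq_of_ae_eq_trim (hm := hm) (μ := P) ?_
  have hk : Measurable[m] fun ω => condExpKernel P m ω s := measurable_condExpKernel hs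
  refine ae_eq_of_forall_setLIntegral_eq_of_sigmaFinite hk hf fun A hA _ => ?_
  rw [restrict_trim hm P hA, lintegral_trim hm hk, lintegral_trim hm hf, h A hA,
    setLIntegral_condExpKernel hm hs hA]

/-- Tower property: under the coarser posterior, the finer one is still a version of the conditional
probability. -/
theorem setLIntegral_condExpKernel_ae_eq (h₁₂ : m₁ ≤ m₂) (h₂ : m₂ ≤ mΩ) {s S : Set Ω} (hs : MeasurableSet s) (hS : MeasurableSet[m₂] S) :
    ∀ᵐ ω ∂P, condExpKernel P m₁ ω (s ∩ S) =
      ∫⁻ ω' in S, condExpKernel P m₂ ω' s ∂(condExpKernel P m₁ ω) := by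
  have hk : Measurable fun ω => condExpKernel P m₂ ω s :=
    (measurable_condExpKernel hs).mono h₂ le_rfl
  have hk' : Measurable (S.indicator fun ω => condExpKernel P m₂ ω s) := hk.indicator (h₂ _ hS)
  refine condExpKernel_apply_ae_eq (h₁₂.trans h₂) (hs.inter (h₂ _ hS)) ?_ fun A hA => ?_
  · simp_rw [← lintegral_indicator (h₂ _ hS)]
    exact hk'.lintegral_kernel
  · simp_rw [← lintegral_indicator (h₂ _ hS)]
    rw [setLIntegral_lintegral_condExpKernel (h₁₂.trans h₂) hk' hA, setLIntegral_indicator (h₂ _ hS),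
      setLIntegral_condExpKernel h₂ hs (hS.inter (h₁₂ _ hA)), Set.inter_assoc]

/-- If `V` is independent of `(Z, H)` then, given `H`, it is independent of `Z` and keeps its
law. -/
theorem condExpKernel_inter_preimage_ae_eq {E F G : Type*} [Finite E] [MeasurableSpace E]
    [MeasurableSingletonClass E] [MeasurableSpace F] [MeasurableSpace.CountablyGenerated F]
    [MeasurableSpace G] {Z : Ω → E} {V : Ω → F} {H : Ω → G} (hZ : Measurable Z) (hV : Measurable V)
    (hH : Measurable H) (h : IndepFun V (fun ω => (Z ω, H ω)) P) :
    ∀ᵐ ω ∂P, ∀ S : Set E, ((condExpKernel P (MeasurableSpace.comap H inferInstance) ω).restrict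
        (Z ⁻¹' S)).map V =
      condExpKernel P (MeasurableSpace.comap H inferInstance) ω (Z ⁻¹' S) • P.map V := by
  have hm : MeasurableSpace.comap H inferInstance ≤ mΩ := hH.comap_le
  rw [ae_all_iff]
  intro S
  have hz : MeasurableSet (Z ⁻¹' S) := hZ S.toFinite.measurableSet
  -- The posterior is a kernel from the σ-algebra of `H`; composing with the identity makes it one
  -- from the ambient σ-algebra, where the almost-everywhere comparison takes place.
  let κ : Kernel Ω Ω := (condExpKernel P (MeasurableSpace.comap H inferInstance)).comap id
    (measurable_id'' hm)
  have hκ : ∀ s, MeasurableSet s → Measurable fun ω => κ ω s := fun s hs => κ.measurable_coe hs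
  let η₁ : Kernel Ω F := (κ.restrict hz).map V
  let η₂ : Kernel Ω F :=
    { toFun := fun ω => κ ω (Z ⁻¹' S) • P.map V
      measurable' := Measure.measurable_of_measurable_coe _ fun B hB => by
        simpa using (hκ _ hz).mul_const _ }
  have : IsFiniteKernel η₂ := ⟨⟨P.map V Set.univ, measure_lt_top _ _, fun ω => by
    change (κ ω (Z ⁻¹' S) • P.map V) Set.univ ≤ _
    simpa using mul_le_of_le_one_left zero_le (prob_le_one)⟩⟩
  have key := Kernel.ae_eq_of_forall_measurableSet (μ := P) (κ := η₁) (η := η₂) fun B hB => by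
    have hVB := hV hB
    have := condExpKernel_apply_ae_eq (P := P) hm (hz.inter hVB)
      (f := fun ω => condExpKernel P (MeasurableSpace.comap H inferInstance) ω (Z ⁻¹' S)
        * P.map V B) ((measurable_condExpKernel hz).mul_const _) fun A hA => by
      have hk : Measurable fun ω => condExpKernel P (MeasurableSpace.comap H inferInstance) ω
          (Z ⁻¹' S) := hκ _ hz
      rw [lintegral_mul_const _ hk, setLIntegral_condExpKernel hm hz hA, Measure.map_apply hV hB]
      obtain ⟨C, hC, rfl⟩ := hA
      have := h.measure_inter_preimage_eq_mul _ _ hB (S.toFinite.measurableSet.prod hC)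
      have e1 : (fun ω => (Z ω, H ω)) ⁻¹' S ×ˢ C = Z ⁻¹' S ∩ H ⁻¹' C := rfl
      rw [e1] at this
      rw [mul_comm, ← this]
      congr 1
      ext ω; simp; tauto
    filter_upwards [this] with ω hω
    change ((κ.restrict hz).map V ω) B = (κ ω (Z ⁻¹' S) • P.map V) B
    rw [Kernel.map_apply _ hV, Kernel.restrict_apply, Measure.map_apply hV hB,
      Measure.restrict_apply hVB, Set.inter_comm]
    simpa [κ] using hω
  filter_upwards [key] with ω hω
  change ((κ.restrict hz).map V) ω = κ ω (Z ⁻¹' S) • P.map V at hω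
  rw [Kernel.map_apply _ hV, Kernel.restrict_apply] at hω
  simpa [κ] using hω

end CondExpKernel

/-! ### Mutual information: measurability, data processing, entropy -/

section MutualInfo

variable {Ω E F G : Type*} [MeasurableSpace Ω] [MeasurableSpace E] [MeasurableSpace F]
  [MeasurableSpace G]

/-- For countably generated `F` the density of one kernel with respect to another has a jointly
measurable version, and absolute continuity holds on a measurable set. -/
theorem measurable_klDiv_kernel [MeasurableSpace.CountablyGenerated F] (κ η : Kernel Ω F)
    [IsFiniteKernel κ] [IsFiniteKernel η] : Measurable fun a => klDiv (κ a) (η a) := by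
  classical
  have h : (fun a => klDiv (κ a) (η a)) = fun a => if κ a ≪ η a then
      ∫⁻ x, ENNReal.ofReal (klFun (κ.rnDeriv η a x).toReal) ∂(η a) else ∞ := by
    funext a
    rw [klDiv_eq_lintegral_klFun]
    refine if_congr Iff.rfl (lintegral_congr_ae ?_) rfl
    filter_upwards [Kernel.rnDeriv_eq_rnDeriv_measure (κ := κ) (η := η) (a := a)] with x hx
    rw [hx]
  rw [h]
  refine Measurable.ite (Kernel.measurableSet_absolutelyContinuous κ η) ?_ measurable_const
  refine Measurable.lintegral_kernel_prod_right' (κ := η)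
    (f := fun p : Ω × F => ENNReal.ofReal (klFun (κ.rnDeriv η p.1 p.2).toReal)) ?_
  exact (measurable_klFun.comp (Kernel.measurable_rnDeriv κ η).ennreal_toReal).ennreal_ofReal

theorem mutualInfo_comm_le {P : Measure Ω} [IsFiniteMeasure P] {X : Ω → E} {Z : Ω → F}
    (hX : Measurable X) (hZ : Measurable Z) : mutualInfo P X Z ≤ mutualInfo P Z X := by
  have h := klDiv_map_le (P.map fun ω => (Z ω, X ω)) ((P.map Z).prod (P.map X)) measurable_swap
  rw [Measure.map_map measurable_swap (hZ.prodMk hX), Measure.prod_swap] at h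
  exact h

theorem mutualInfo_comp_left_le {P : Measure Ω} [IsFiniteMeasure P] {X : Ω → E} {Z : Ω → F}
    (hX : Measurable X) (hZ : Measurable Z) {c : E → G} (hc : Measurable c) :
    mutualInfo P (c ∘ X) Z ≤ mutualInfo P X Z := by
  have h := klDiv_map_le (P.map fun ω => (X ω, Z ω)) ((P.map X).prod (P.map Z))
    (hc.prodMap measurable_id : Measurable (Prod.map c (id : F → F)))
  rw [Measure.map_map (hc.prodMap measurable_id) (hX.prodMk hZ),
    ← Measure.map_prod_map _ _ hc measurable_id, Measure.map_id, Measure.map_map hc hX] at h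
  exact h

/-- Two measures on `E × F`, `E` countable, agree if they agree on slices. -/
theorem MeasureTheory.Measure.ext_prod_singleton [Countable E] [MeasurableSingletonClass E]
    {μ ν : Measure (E × F)} (h : ∀ e B, MeasurableSet B → μ ({e} ×ˢ B) = ν ({e} ×ˢ B)) :
    μ = ν := by
  ext S hS
  have hdec : S = ⋃ e : E, {e} ×ˢ (Prod.mk e ⁻¹' S) := by
    ext ⟨e, f⟩; simp
  have hm : ∀ e, MeasurableSet ((Prod.mk e) ⁻¹' S : Set F) := fun e => measurable_prodMk_left hS
  have hd : Pairwise (Function.onFun Disjoint fun e : E => ({e} ×ˢ (Prod.mk e ⁻¹' S) : Set (E × F))) := by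
    intro a b hab
    refine Set.disjoint_left.2 ?_
    rintro ⟨x, y⟩ ⟨h1, -⟩ ⟨h2, -⟩
    exact hab (h1.symm.trans h2)
  rw [hdec, measure_iUnion hd fun e => (measurableSet_singleton e).prod (hm e),
    measure_iUnion hd fun e => (measurableSet_singleton e).prod (hm e)]
  exact tsum_congr fun e => h e _ (hm e)

theorem measure_eq_sum_inter_preimage [Fintype E] [MeasurableSingletonClass E] {Q : Measure Ω}
    {f : Ω → E} (hf : Measurable f) {S : Set Ω} (hS : MeasurableSet S) :
    Q S = ∑ e, Q (S ∩ f ⁻¹' {e}) := by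
  conv_lhs => rw [show S = ⋃ e, S ∩ f ⁻¹' {e} by ext; simp]
  rw [measure_iUnion _ fun e => hS.inter (hf (measurableSet_singleton e)), tsum_fintype]
  intro i j hij
  exact Set.disjoint_left.2 fun ω h1 h2 => hij (h1.2.symm.trans h2.2)

/-- **Data processing**: a statistic that depends on `V` only through `ψ` is no more informative on
`V` than `ψ`. -/
theorem mutualInfo_le_of_cond_indep {K : ℕ} [Countable E] [MeasurableSingletonClass E]
    {Q : Measure Ω} [IsProbabilityMeasure Q] {ψ : Ω → Fin K} {U : Ω → E} {V : Ω → F}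
    (hψ : Measurable ψ) (hU : Measurable U) (hV : Measurable V)
    (h : ∀ k a B, MeasurableSet B →
      Q (ψ ⁻¹' {k} ∩ U ⁻¹' {a} ∩ V ⁻¹' B) * Q (ψ ⁻¹' {k}) =
        Q (ψ ⁻¹' {k} ∩ U ⁻¹' {a}) * Q (ψ ⁻¹' {k} ∩ V ⁻¹' B)) :
    mutualInfo Q U V ≤ mutualInfo Q ψ V := by
  classical
  have hk : ∀ k, MeasurableSet (ψ ⁻¹' {k}) := fun k => hψ (measurableSet_singleton k)
  have ha : ∀ a, MeasurableSet (U ⁻¹' {a}) := fun a => hU (measurableSet_singleton a)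
  -- On a null cell any probability law would do; the default value keeps `κ` Markov.
  let q : Fin K → Measure E := fun k =>
    if Q (ψ ⁻¹' {k}) = 0 then Q.map U else (ProbabilityTheory.cond Q (ψ ⁻¹' {k})).map U
  have hq : ∀ k, IsProbabilityMeasure (q k) := fun k => by
    by_cases h0 : Q (ψ ⁻¹' {k}) = 0
    · simp only [q, h0, if_true]; exact Measure.isProbabilityMeasure_map hU.aemeasurable
    · simp only [q, h0, if_false]
      have := cond_isProbabilityMeasure h0
      exact Measure.isProbabilityMeasure_map hU.aemeasurable
  have hqa : ∀ k a, Q (ψ ⁻¹' {k}) * q k {a} = Q (ψ ⁻¹' {k} ∩ U ⁻¹' {a}) := fun k a => by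
    by_cases h0 : Q (ψ ⁻¹' {k}) = 0
    · rw [h0, zero_mul, measure_mono_null Set.inter_subset_left h0]
    · simp only [q, h0, if_false]
      rw [Measure.map_apply hU (measurableSet_singleton a), cond_apply (hk k), ← mul_assoc,
        ENNReal.mul_inv_cancel h0 (measure_ne_top _ _), one_mul]
  have hqaB : ∀ k a B, MeasurableSet B → Q (ψ ⁻¹' {k} ∩ V ⁻¹' B) * q k {a} =
      Q (ψ ⁻¹' {k} ∩ U ⁻¹' {a} ∩ V ⁻¹' B) := fun k a B hB => by
    by_cases h0 : Q (ψ ⁻¹' {k}) = 0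
    · rw [measure_mono_null Set.inter_subset_left h0, zero_mul,
        measure_mono_null (Set.inter_subset_left.trans Set.inter_subset_left) h0]
    · have := h k a B hB
      rw [← hqa, mul_comm, mul_assoc] at this
      rw [(ENNReal.mul_right_inj h0 (measure_ne_top _ _)).1 this, mul_comm]
  have hsum : ∀ S, MeasurableSet S → Q S = ∑ k, Q (ψ ⁻¹' {k} ∩ S) := fun S hS => by
    simp_rw [Set.inter_comm _ S]
    exact measure_eq_sum_inter_preimage hψ hS
  let κ : Kernel (Fin K) E := Kernel.mk q (measurable_of_finite _)
  have : IsMarkovKernel κ := ⟨hq⟩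
  -- The channel redraws `U` from `ψ` and keeps `V`. By conditional independence it sends the law of
  -- `(ψ, V)` to that of `(U, V)`, and the product of marginals to the product of marginals, so the
  -- divergence can only decrease.
  let κ' : Kernel (Fin K × F) (E × F) := κ ∥ₖ Kernel.id
  have hκ := klDiv_comp_right_le (Q.map fun ω => (ψ ω, V ω)) ((Q.map ψ).prod (Q.map V))
    κ'
  have hbind : ∀ (μ : Measure (Fin K × F)) a B, MeasurableSet B →
      (κ' ∘ₘ μ) ({a} ×ˢ B) = ∑ k, μ ({k} ×ˢ B) * q k {a} := fun μ a B hB => by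
    have hint : ∀ p : Fin K × F, κ' p ({a} ×ˢ B) =
        ∑ k, ({k} ×ˢ B : Set (Fin K × F)).indicator (fun _ => q k {a}) p := by
      rintro ⟨k, v⟩
      simp only [κ']
      rw [Kernel.parallelComp_apply, Measure.prod_prod, Kernel.id_apply, Measure.dirac_apply' _ hB,
        Finset.sum_eq_single k]
      · by_cases hv : v ∈ B <;> simp [hv, κ]
      · intro j _ hj
        simp [Ne.symm hj]
      · simp
    rw [Measure.bind_apply ((measurableSet_singleton a).prod hB) (Kernel.aemeasurable _)]
    simp_rw [hint]
    rw [lintegral_finsetSum _ fun k _ =>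
      measurable_const.indicator ((measurableSet_singleton k).prod hB)]
    refine Finset.sum_congr rfl fun k _ => ?_
    rw [lintegral_indicator_const ((measurableSet_singleton k).prod hB), mul_comm]
  have e1 : κ' ∘ₘ (Q.map fun ω => (ψ ω, V ω)) = Q.map fun ω => (U ω, V ω) := by
    refine Measure.ext_prod_singleton fun a B hB => ?_
    rw [hbind _ a B hB, Measure.map_apply (hU.prodMk hV) ((measurableSet_singleton a).prod hB),
      hsum _ ((hU.prodMk hV) ((measurableSet_singleton a).prod hB))]
    refine Finset.sum_congr rfl fun k _ => ?_
    rw [Measure.map_apply (hψ.prodMk hV) ((measurableSet_singleton k).prod hB)]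
    exact (hqaB k a B hB).trans (by rw [Set.inter_assoc]; rfl)
  have e2 : κ' ∘ₘ ((Q.map ψ).prod (Q.map V)) = (Q.map U).prod (Q.map V) := by
    refine Measure.ext_prod_singleton fun a B hB => ?_
    rw [hbind _ a B hB, Measure.prod_prod, Measure.map_apply hU (measurableSet_singleton a),
      hsum _ (ha a), Finset.sum_mul]
    refine Finset.sum_congr rfl fun k _ => ?_
    rw [Measure.prod_prod, Measure.map_apply hψ (measurableSet_singleton k), ← hqa, mul_right_comm]
  rw [e1, e2] at hκ
  exact hκ

theorem integrable_negMulLog_toReal {P : Measure Ω}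
    [IsFiniteMeasure P] {D : Ω → ℝ≥0∞} (hD : Measurable D) (hD1 : ∀ ω, D ω ≤ 1) :
    Integrable (fun ω => Real.negMulLog (D ω).toReal) P := by
  have hd1 : ∀ x, (D x).toReal ≤ 1 := fun x => by
    simpa using ENNReal.toReal_mono ENNReal.one_ne_top (hD1 x)
  refine Integrable.of_bound (C := 1)
    (Real.continuous_negMulLog.measurable.comp hD.ennreal_toReal).aestronglyMeasurable
    (ae_of_all _ fun x => ?_)
  rw [Real.norm_of_nonneg (Real.negMulLog_nonneg ENNReal.toReal_nonneg (hd1 x))]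
  have := Real.negMulLog_le_one_sub_self (x := (D x).toReal) ENNReal.toReal_nonneg
  linarith [ENNReal.toReal_nonneg (a := D x)]

open Real in
-- One summand of a divergence. With `p = ∫ D`, the integrand `p * klFun (D / p)` is `-negMulLog D`
-- plus terms affine in `D`, whose integrals add up to `negMulLog p`. Nonnegativity of `klFun`
-- replaces Jensen's inequality.
theorem lintegral_klFun_div_mul {Q : Measure F} [IsProbabilityMeasure Q] {D : F → ℝ≥0∞}
    (hD : Measurable D) (hD1 : ∀ x, D x ≤ 1) :
    0 ≤ negMulLog (∫⁻ x, D x ∂Q).toReal - ∫ x, negMulLog (D x).toReal ∂Q ∧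
    (∫⁻ x, ENNReal.ofReal (klFun (D x / ∫⁻ x, D x ∂Q).toReal) ∂Q) * ∫⁻ x, D x ∂Q =
      ENNReal.ofReal (negMulLog (∫⁻ x, D x ∂Q).toReal - ∫ x, negMulLog (D x).toReal ∂Q) := by
  set p := ∫⁻ x, D x ∂Q with hp
  have hp1 : p ≤ 1 := by
    calc p ≤ ∫⁻ _, 1 ∂Q := lintegral_mono hD1
      _ = 1 := by simp
  have hpt : p ≠ ∞ := ne_top_of_le_ne_top ENNReal.one_ne_top hp1
  have hDt : ∀ x, D x ≠ ∞ := fun x => ne_top_of_le_ne_top ENNReal.one_ne_top (hD1 x)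
  by_cases h0 : p = 0
  · have hz : ∀ᵐ x ∂Q, D x = 0 := (lintegral_eq_zero_iff hD).1 h0
    have : ∫ x, negMulLog (D x).toReal ∂Q = 0 := by
      refine integral_eq_zero_of_ae ?_
      filter_upwards [hz] with x hx
      simp [hx]
    simp [h0, this]
  have hpr : 0 < p.toReal := ENNReal.toReal_pos h0 hpt
  have hdi : Integrable (fun x => (D x).toReal) Q :=
    integrable_toReal_of_lintegral_ne_top hD.aemeasurable hpt
  have hdint : ∫ x, (D x).toReal ∂Q = p.toReal :=
    integral_toReal hD.aemeasurable (ae_of_all _ fun x => (hDt x).lt_top)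
  have hhi := integrable_negMulLog_toReal (P := Q) hD hD1
  have hpt' : ∀ x, p.toReal * klFun (D x / p).toReal =
      (-negMulLog (D x).toReal) + (-(log p.toReal) - 1) * (D x).toReal + p.toReal := fun x => by
    rw [ENNReal.toReal_div, klFun_apply, negMulLog]
    by_cases hx : (D x).toReal = 0
    · simp [hx]
    · rw [log_div hx hpr.ne']
      field_simp
      ring
  have hki : Integrable (fun x => p.toReal * klFun (D x / p).toReal) Q := by
    simp_rw [hpt']
    exact (hhi.neg.add (hdi.const_mul _)).add (integrable_const _)
  have hkint : ∫ x, p.toReal * klFun (D x / p).toReal ∂Q =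
      negMulLog p.toReal - ∫ x, negMulLog (D x).toReal ∂Q := by
    simp_rw [hpt']
    rw [integral_add (f := fun x => -negMulLog (D x).toReal + (-log p.toReal - 1) * (D x).toReal)
        (hhi.neg.add (hdi.const_mul _)) (integrable_const _),
      integral_add (f := fun x => -negMulLog (D x).toReal) hhi.neg (hdi.const_mul _), integral_neg, integral_const_mul, hdint]
    simp [negMulLog]
    ring
  have hnn : ∀ x, 0 ≤ p.toReal * klFun (D x / p).toReal := fun x =>
    mul_nonneg hpr.le (klFun_nonneg ENNReal.toReal_nonneg)
  refine ⟨hkint ▸ integral_nonneg hnn, ?_⟩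
  rw [← hkint, ofReal_integral_eq_lintegral_ofReal hki (ae_of_all _ hnn), mul_comm,
    ← lintegral_const_mul' _ _ hpt]
  refine lintegral_congr fun x => ?_
  rw [ENNReal.ofReal_mul hpr.le, ENNReal.ofReal_toReal hpt]

theorem measurable_div_measure_singleton {K : ℕ} (p : Measure (Fin K)) {D : Fin K → F → ℝ≥0∞}
    (hD : ∀ k, Measurable (D k)) : Measurable fun y : Fin K × F => D y.1 y.2 / p {y.1} := by
  refine measurable_from_prod_countable_right fun k => ?_
  have h : Measurable fun x => D k x / p {k} := (hD k).div measurable_const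
  exact h

open Real in
/-- The divergence, from the product of its marginals, of the law of a pair `(k, x)` in which `k`
has the conditional probabilities `D k x` given `x`. -/
theorem klDiv_withDensity_prod {K : ℕ} {p : Measure (Fin K)} [IsProbabilityMeasure p]
    {Q : Measure F} [IsProbabilityMeasure Q] {D : Fin K → F → ℝ≥0∞} (hD : ∀ k, Measurable (D k))
    (hD1 : ∀ k x, D k x ≤ 1) (hp : ∀ k, ∫⁻ x, D k x ∂Q = p {k}) :
    (∀ k, 0 ≤ negMulLog (p {k}).toReal - ∫ x, negMulLog (D k x).toReal ∂Q) ∧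
    klDiv ((p.prod Q).withDensity fun y => D y.1 y.2 / p {y.1}) (p.prod Q) =
      ENNReal.ofReal (∑ k, (negMulLog (p {k}).toReal - ∫ x, negMulLog (D k x).toReal ∂Q)) := by
  have hnn : ∀ k, 0 ≤ negMulLog (p {k}).toReal - ∫ x, negMulLog (D k x).toReal ∂Q := fun k => by
    rw [← hp k]; exact (lintegral_klFun_div_mul (hD k) (hD1 k)).1
  refine ⟨hnn, ?_⟩
  have hf := measurable_div_measure_singleton p hD
  have hprod : ∀ G : Fin K × F → ℝ≥0∞, Measurable G →
      ∫⁻ y, G y ∂(p.prod Q) = ∑ k, (∫⁻ x, G (k, x) ∂Q) * p {k} := fun G hG => by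
    rw [lintegral_prod _ hG.aemeasurable, lintegral_fintype]
  have hfin : IsFiniteMeasure ((p.prod Q).withDensity fun y => D y.1 y.2 / p {y.1}) := by
    refine isFiniteMeasure_withDensity ?_
    rw [hprod _ hf]
    refine (ENNReal.sum_lt_top.2 fun k _ => ?_).ne
    -- On a null cell the density may be infinite, but it carries weight `p {k} = 0`.
    by_cases h0 : p {k} = 0
    · simp [h0]
    · refine ENNReal.mul_lt_top ?_ (measure_lt_top _ _)
      simp_rw [div_eq_mul_inv]
      rw [lintegral_mul_const _ (hD k), hp k]
      exact ENNReal.mul_lt_top (measure_lt_top _ _) (by simpa [pos_iff_ne_zero] using h0)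
  rw [klDiv_eq_lintegral_klFun_of_ac (withDensity_absolutelyContinuous _ _),
    lintegral_congr_ae (g := fun y => ENNReal.ofReal (klFun (D y.1 y.2 / p {y.1}).toReal))
      (by filter_upwards [Measure.rnDeriv_withDensity (p.prod Q) hf] with y hy; rw [hy]),
    hprod (fun y => ENNReal.ofReal (klFun (D y.1 y.2 / p {y.1}).toReal))
      (measurable_klFun.comp hf.ennreal_toReal).ennreal_ofReal,
    ENNReal.ofReal_sum_of_nonneg fun k _ => hnn k]
  refine Finset.sum_congr rfl fun k _ => ?_
  have h := (lintegral_klFun_div_mul (Q := Q) (hD k) (hD1 k)).2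
  rw [hp k] at h
  exact h

theorem withDensity_prod_apply {K : ℕ} {p : Measure (Fin K)} [IsProbabilityMeasure p]
    {Q : Measure F} [IsProbabilityMeasure Q] {D : Fin K → F → ℝ≥0∞} (hD : ∀ k, Measurable (D k))
    (hp : ∀ k, ∫⁻ x, D k x ∂Q = p {k}) (k : Fin K) {B : Set F} (hB : MeasurableSet B) :
    ((p.prod Q).withDensity fun y => D y.1 y.2 / p {y.1}) ({k} ×ˢ B) = ∫⁻ x in B, D k x ∂Q := by
  have hf := measurable_div_measure_singleton p hD
  rw [withDensity_apply _ ((measurableSet_singleton k).prod hB), ← Measure.prod_restrict,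
    lintegral_prod _ hf.aemeasurable, lintegral_singleton]
  by_cases h0 : p {k} = 0
  · rw [h0, mul_zero]
    have : ∀ᵐ x ∂Q, D k x = 0 := (lintegral_eq_zero_iff (hD k)).1 ((hp k).trans h0)
    exact ((lintegral_eq_zero_iff (hD k)).2 (ae_restrict_of_ae this)).symm
  · simp_rw [div_eq_mul_inv]
    rw [lintegral_mul_const _ (hD k), mul_assoc, ENNReal.inv_mul_cancel h0 (measure_ne_top _ _),
      mul_one]

open Real in
/-- If the `D k` are versions of the probabilities of `ψ = k` given some information that includes
`Z`, then `Z` is no more informative on `ψ` than that information. -/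
theorem mutualInfo_le_entropy_sub {K : ℕ} {Q : Measure Ω} [IsProbabilityMeasure Q]
    {ψ : Ω → Fin K} {Z : Ω → F} (hψ : Measurable ψ) (hZ : Measurable Z) {D : Fin K → Ω → ℝ≥0∞}
    (hD : ∀ k, Measurable (D k)) (hD1 : ∀ k x, D k x ≤ 1)
    (h : ∀ k B, MeasurableSet B → Q (ψ ⁻¹' {k} ∩ Z ⁻¹' B) = ∫⁻ x in Z ⁻¹' B, D k x ∂Q) :
    0 ≤ ∑ k, (negMulLog (Q (ψ ⁻¹' {k})).toReal - ∫ x, negMulLog (D k x).toReal ∂Q) ∧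
    mutualInfo Q ψ Z ≤ ENNReal.ofReal
      (∑ k, (negMulLog (Q (ψ ⁻¹' {k})).toReal - ∫ x, negMulLog (D k x).toReal ∂Q)) := by
  have : IsProbabilityMeasure (Q.map ψ) := Measure.isProbabilityMeasure_map hψ.aemeasurable
  have hpk : ∀ k, (Q.map ψ) {k} = Q (ψ ⁻¹' {k}) := fun k =>
    Measure.map_apply hψ (measurableSet_singleton k)
  have hp : ∀ k, ∫⁻ x, D k x ∂Q = (Q.map ψ) {k} := fun k => by
    have := h k Set.univ MeasurableSet.univ
    simp only [Set.preimage_univ, Set.inter_univ, Measure.restrict_univ] at this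
    rw [hpk, this]
  obtain ⟨h1, h2⟩ := klDiv_withDensity_prod (p := Q.map ψ) hD hD1 hp
  simp_rw [hpk] at h1
  have h3 : (∑ k, (negMulLog (Q (ψ ⁻¹' {k})).toReal - ∫ x, negMulLog (D k x).toReal ∂Q)) =
    ∑ k, (negMulLog ((Q.map ψ) {k}).toReal - ∫ x, negMulLog (D k x).toReal ∂Q) := by
    simp_rw [hpk]
  refine ⟨Finset.sum_nonneg fun k _ => h1 k, ?_⟩
  have hfin : IsFiniteMeasure
      (((Q.map ψ).prod Q).withDensity fun y => D y.1 y.2 / (Q.map ψ) {y.1}) := by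
    refine ⟨?_⟩
    have : (Set.univ : Set (Fin K × Ω)) = ⋃ k, {k} ×ˢ Set.univ := by ext; simp
    rw [this]
    refine (measure_iUnion_fintype_le _ _).trans_lt (ENNReal.sum_lt_top.2 fun k _ => ?_)
    rw [withDensity_prod_apply hD hp k MeasurableSet.univ, Measure.restrict_univ, hp k]
    exact measure_lt_top _ _
  -- The map `id × Z` sends the density measure to the law of `(ψ, Z)` and its reference measure to
  -- the product of marginals, so data processing gives the bound.
  have hg : Measurable (Prod.map (id : Fin K → Fin K) Z) := measurable_id.prodMap hZ
  have hle := klDiv_map_le (((Q.map ψ).prod Q).withDensity fun y => D y.1 y.2 / (Q.map ψ) {y.1})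
    ((Q.map ψ).prod Q) hg
  rw [h3, ← h2]
  refine le_trans (le_of_eq ?_) hle
  rw [mutualInfo, ← Measure.map_prod_map _ _ measurable_id hZ, Measure.map_id]
  congr 1
  refine Measure.ext_prod_singleton fun k B hB => ?_
  have hkB := (measurableSet_singleton k).prod hB
  rw [Measure.map_apply (hψ.prodMk hZ) hkB, Measure.map_apply hg hkB]
  have e1 : Prod.map (id : Fin K → Fin K) Z ⁻¹' ({k} ×ˢ B) = {k} ×ˢ (Z ⁻¹' B) := rfl
  rw [e1, withDensity_prod_apply hD hp k (hZ hB), ← h k B hB]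
  rfl

open Real in
-- Given `ψ` itself, the conditional probabilities are indicators, and `negMulLog` vanishes at `0`
-- and `1`; only the entropy remains.
theorem mutualInfo_self {K : ℕ} {Q : Measure Ω} [IsProbabilityMeasure Q]
    {ψ : Ω → Fin K} (hψ : Measurable ψ) :
    mutualInfo Q ψ ψ = ENNReal.ofReal (∑ k, negMulLog (Q (ψ ⁻¹' {k})).toReal) := by
  have : IsProbabilityMeasure (Q.map ψ) := Measure.isProbabilityMeasure_map hψ.aemeasurable
  let D : Fin K → Fin K → ℝ≥0∞ := fun k => ({k} : Set (Fin K)).indicator 1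
  have hD : ∀ k, Measurable (D k) := fun k => measurable_of_finite _
  have hp : ∀ k, ∫⁻ x, D k x ∂(Q.map ψ) = (Q.map ψ) {k} := fun k => by
    exact lintegral_indicator_one (measurableSet_singleton k)
  have h := (klDiv_withDensity_prod (p := Q.map ψ) (Q := Q.map ψ) hD
    (fun k x => Set.indicator_le_self' (fun _ _ => zero_le) x) hp).2
  have hz : ∀ k, ∫ x, negMulLog (D k x).toReal ∂(Q.map ψ) = 0 := fun k => by
    refine integral_eq_zero_of_ae (ae_of_all _ fun x => ?_)
    by_cases hx : x = k <;> simp [D, hx]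
  simp_rw [hz, sub_zero, Measure.map_apply hψ (measurableSet_singleton _)] at h
  rw [← h, mutualInfo]
  congr 1
  refine Measure.ext_prod_singleton fun k B hB => ?_
  have h2 := withDensity_prod_apply hD hp k hB
  simp_rw [Measure.map_apply hψ (measurableSet_singleton _)] at h2
  rw [h2, Measure.map_apply (hψ.prodMk hψ) ((measurableSet_singleton k).prod hB),
    lintegral_indicator_one (measurableSet_singleton k),
    Measure.restrict_apply (measurableSet_singleton k),
    Measure.map_apply hψ ((measurableSet_singleton k).inter hB)]
  rfl

end MutualInfo

theorem integral_integral_condExpKernel {Ω : Type*} {m : MeasurableSpace Ω}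
    [mΩ : MeasurableSpace Ω] [StandardBorelSpace Ω] {P : Measure Ω} [IsFiniteMeasure P]
    (hm : m ≤ mΩ) {f : Ω → ℝ} (hf : Integrable f P) :
    ∫ ω, ∫ ω', f ω' ∂(condExpKernel P m ω) ∂P = ∫ ω, f ω ∂P := by
  rw [← integral_condExp (f := f) hm]
  exact integral_congr_ae (condExp_ae_eq_integral_condExpKernel hm hf).symm

/-! ### Rewards and outcomes under a posterior -/

namespace Bandit

variable {A Θ 𝒲 Y Ω : Type*} [MeasurableSpace 𝒲] [MeasurableSpace Y] [MeasurableSpace Ω]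

theorem exists_abs_R_le (B : Bandit A Θ 𝒲 Y) : ∃ C, ∀ y, |B.R y| ≤ C := by
  rcases isEmpty_or_nonempty Y with h | ⟨⟨y₀⟩⟩
  · exact ⟨0, fun y => (h.false y).elim⟩
  · refine ⟨|B.R y₀| + 1, fun y => ?_⟩
    have h1 := B.R_range y y₀
    have h2 := B.R_range y₀ y
    have : |B.R y - B.R y₀| ≤ 1 := abs_le.2 ⟨by linarith, by linarith⟩
    have := abs_sub_abs_le_abs_sub (B.R y) (B.R y₀)
    linarith

theorem integrable_R_comp (B : Bandit A Θ 𝒲 Y) {Q : Measure Ω} [IsFiniteMeasure Q] {f : Ω → Y}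
    (hf : Measurable f) : Integrable (fun ω => B.R (f ω)) Q := by
  obtain ⟨C, hC⟩ := B.exists_abs_R_le
  exact Integrable.of_bound (C := C) (B.measurable_R.comp hf).aestronglyMeasurable
    (ae_of_all _ fun ω => hC _)

section Measurability

variable [Finite Θ] [MeasurableSpace Θ] [MeasurableSingletonClass Θ]

theorem measurable_outcome (B : Bandit A Θ 𝒲 Y) (α : Θ → A) {X : Run Θ 𝒲 Ω} {t : ℕ} {ϑ : Ω → Θ}
    (h₁ : Measurable X.θstar) (h₂ : Measurable (X.W t)) (h₃ : Measurable ϑ) :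
    Measurable (B.outcome α X t ϑ) := by
  have h : Measurable fun p : (Θ × Θ) × 𝒲 => B.g (α p.1.1) p.1.2 p.2 := by
    refine measurable_from_prod_countable_right fun q => ?_
    have h := B.measurable_g (α q.1) q.2
    exact h
  exact h.comp ((h₃.prodMk h₁).prodMk h₂)

theorem measurable_history (B : Bandit A Θ 𝒲 Y) (α : Θ → A) {X : Run Θ 𝒲 Ω}
    (h₁ : Measurable X.θstar) (h₂ : ∀ t, Measurable (X.W t)) (h₃ : ∀ t, Measurable (X.θ t))
    (t : ℕ) : Measurable (B.history α X t) :=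
  measurable_pi_lambda _ fun s =>
    (h₃ s).prodMk (B.measurable_outcome α h₁ (h₂ s) (h₃ s))

theorem integrable_bestReward (B : Bandit A Θ 𝒲 Y) (α : Θ → A) {X : Run Θ 𝒲 Ω} {Q : Measure Ω}
    [IsFiniteMeasure Q] (h : Measurable X.θstar) : Integrable (B.bestReward α X) Q := by
  have : Fintype Θ := Fintype.ofFinite Θ
  refine Integrable.of_bound (C := ∑ θ, |B.mean (α θ) θ|)
    ((measurable_of_finite fun θ => B.mean (α θ) θ).comp h).aestronglyMeasurable
    (ae_of_all _ fun ω => ?_)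
  exact Finset.single_le_sum (f := fun θ => |B.mean (α θ) θ|) (fun _ _ => abs_nonneg _)
    (Finset.mem_univ (X.θstar ω))

end Measurability

/-- Under `Q`, the outcomes of all actions for all parameters are independent of `Z`, and have the
laws that the noise law prescribes. -/
def OutcomesIndep {E : Type*} (B : Bandit A Θ 𝒲 Y) (Q : Measure Ω) (W : Ω → 𝒲) (Z : Ω → E) :
    Prop :=
  ∀ (S : Set E) a θ, (Q.restrict (Z ⁻¹' S)).map (fun ω => B.g a θ (W ω)) =
    Q (Z ⁻¹' S) • B.ν.map (B.g a θ)

/-- No countability is assumed of the noise space, so independence of the noise is passed to the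
posterior only through the finitely many variables `B.g a θ (W t)`, which take values in the
countably generated `Y`. -/
theorem ae_outcomesIndep {E : Type*} [Finite A] [Finite Θ] [MeasurableSpace Θ]
    [MeasurableSingletonClass Θ]
    [MeasurableSpace.CountablyGenerated Y] [Finite E] [MeasurableSpace E]
    [MeasurableSingletonClass E] {B : Bandit A Θ 𝒲 Y}
    {α : Θ → A} [StandardBorelSpace Ω] {P : Measure Ω} [IsProbabilityMeasure P] {X : Run Θ 𝒲 Ω}
    (hX : B.IsThompsonSampling α P X) {t : ℕ} {Z : Ω → E} (hZ : Measurable Z)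
    (h : IndepFun (X.W t) (fun ω => (Z ω, B.history α X t ω)) P) :
    ∀ᵐ ω ∂P, B.OutcomesIndep (B.posterior α P X t ω) (X.W t) Z := by
  have h' : ∀ a θ, ∀ᵐ ω ∂P, ∀ S : Set E,
      ((B.posterior α P X t ω).restrict (Z ⁻¹' S)).map (fun ω => B.g a θ (X.W t ω)) =
        B.posterior α P X t ω (Z ⁻¹' S) • B.ν.map (B.g a θ) := fun a θ => by
    have h1 : IndepFun (fun ω => B.g a θ (X.W t ω)) (fun ω => (Z ω, B.history α X t ω)) P :=
      h.comp (B.measurable_g a θ) measurable_id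
    have h2 := condExpKernel_inter_preimage_ae_eq hZ
      ((B.measurable_g a θ).comp (hX.measurable_W t))
      (B.measurable_history α hX.measurable_θstar hX.measurable_W hX.measurable_θ t) h1
    have h3 : P.map (B.g a θ ∘ X.W t) = B.ν.map (B.g a θ) := by
      rw [← Measure.map_map (B.measurable_g a θ) (hX.measurable_W t), hX.noise_law t]
    rw [h3] at h2
    exact h2
  filter_upwards [ae_all_iff.2 fun a => ae_all_iff.2 fun θ => h' a θ] with ω hω S a θ
  exact hω a θ S

theorem OutcomesIndep.measure_inter {E : Type*} {B : Bandit A Θ 𝒲 Y} {Q : Measure Ω} {W : Ω → 𝒲}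
    (hW : Measurable W) {Z : Ω → E} (h : B.OutcomesIndep Q W Z) (S : Set E) (a : A) (θ : Θ)
    {C : Set Y} (hC : MeasurableSet C) :
    Q ((fun ω => B.g a θ (W ω)) ⁻¹' C ∩ Z ⁻¹' S) = Q (Z ⁻¹' S) * B.ν (B.g a θ ⁻¹' C) := by
  have hg : Measurable fun ω => B.g a θ (W ω) := (B.measurable_g a θ).comp hW
  have := congrArg (fun μ => μ C) (h S a θ)
  simpa [Measure.map_apply hg hC, Measure.restrict_apply (hg hC),
    Measure.map_apply (B.measurable_g a θ) hC] using this

theorem OutcomesIndep.setIntegral {E : Type*} {B : Bandit A Θ 𝒲 Y} {Q : Measure Ω}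
    {W : Ω → 𝒲} (hW : Measurable W) {Z : Ω → E} (h : B.OutcomesIndep Q W Z) (S : Set E) (a : A)
    (θ : Θ) : ∫ ω in Z ⁻¹' S, B.R (B.g a θ (W ω)) ∂Q = Q.real (Z ⁻¹' S) * B.mean a θ := by
  have hg : Measurable fun ω => B.g a θ (W ω) := (B.measurable_g a θ).comp hW
  rw [← integral_map (f := B.R) (φ := fun ω => B.g a θ (W ω)) hg.aemeasurable
    B.measurable_R.aestronglyMeasurable, h S a θ, integral_smul_measure,
    integral_map (B.measurable_g a θ).aemeasurable B.measurable_R.aestronglyMeasurable]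
  rfl

/-- Splitting over the values of `Z` integrates the noise out and leaves a finite sum. The weight
`u` admits indicators of target and sample. -/
theorem OutcomesIndep.integral {E : Type*} [Fintype E] [MeasurableSpace E]
    [MeasurableSingletonClass E] {B : Bandit A Θ 𝒲 Y} {Q : Measure Ω} [IsFiniteMeasure Q]
    {W : Ω → 𝒲} (hW : Measurable W) {Z : Ω → E} (hZ : Measurable Z) (h : B.OutcomesIndep Q W Z)
    (u : E → ℝ) (a : E → A) (c : E → Θ) :
    ∫ ω, u (Z ω) * B.R (B.g (a (Z ω)) (c (Z ω)) (W ω)) ∂Q =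
      ∑ z, Q.real (Z ⁻¹' {z}) * (u z * B.mean (a z) (c z)) := by
  classical
  have hz : ∀ z, MeasurableSet (Z ⁻¹' {z}) := fun z => hZ (measurableSet_singleton z)
  have h1 : ∀ ω, u (Z ω) * B.R (B.g (a (Z ω)) (c (Z ω)) (W ω)) =
      ∑ z, (Z ⁻¹' {z}).indicator (fun ω => u z * B.R (B.g (a z) (c z) (W ω))) ω := fun ω => by
    rw [Finset.sum_eq_single (Z ω)]
    · simp
    · intro z _ hzω
      exact Set.indicator_of_notMem (fun h => hzω h.symm) _
    · simp
  simp_rw [h1]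
  have h2 : ∀ z, Integrable
      ((Z ⁻¹' {z}).indicator fun ω => u z * B.R (B.g (a z) (c z) (W ω))) Q := fun z =>
    ((B.integrable_R_comp ((B.measurable_g _ _).comp hW)).const_mul _).indicator (hz z)
  rw [integral_finsetSum _ fun z _ => h2 z]
  refine Finset.sum_congr rfl fun z _ => ?_
  rw [integral_indicator (hz z), integral_const_mul, h.setIntegral hW]
  ring

end Bandit

/-! ### Target and sample under a single posterior -/

namespace Bandit

variable {A Θ 𝒲 Y Ω : Type*} [Finite Θ] [MeasurableSpace Θ] [MeasurableSingletonClass Θ]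
  [MeasurableSpace 𝒲] [MeasurableSpace Y] [MeasurableSpace Ω]

/-- If the sample reveals nothing about the target, it earns as much as the target. -/
theorem integral_sub_eq_zero_of_mutualInfo_eq_zero {B : Bandit A Θ 𝒲 Y} {α : Θ → A}
    {Q : Measure Ω} [IsProbabilityMeasure Q] {X : Run Θ 𝒲 Ω} {t : ℕ} {τstar τ : Ω → Θ}
    (hθ : Measurable X.θstar) (hW : Measurable (X.W t)) (hτs : Measurable τstar)
    (hτ : Measurable τ)
    (hN : B.OutcomesIndep Q (X.W t) fun ω => (τstar ω, τ ω, X.θstar ω))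
    (hlaw : Q.map τ = Q.map τstar) (hind : IndepFun τ (fun ω => (τstar ω, X.θstar ω)) Q)
    (h0 : mutualInfo Q τstar (fun ω => (τ ω, B.outcome α X t τ ω)) = 0) :
    ∫ ω, (B.R (B.outcome α X t τstar ω) - B.R (B.outcome α X t τ ω)) ∂Q = 0 := by
  classical
  have : Fintype Θ := Fintype.ofFinite Θ
  have hYs := B.measurable_outcome α hθ hW hτs
  have hY := B.measurable_outcome α hθ hW hτ
  have hindep : IndepFun τstar (fun ω => (τ ω, B.outcome α X t τ ω)) Q := by
    rw [indepFun_iff_map_prod_eq_prod_map_map hτs.aemeasurable (hτ.prodMk hY).aemeasurable]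
    exact klDiv_eq_zero_iff.1 h0
  set Z : Ω → Θ × Θ × Θ := fun ω => (τstar ω, τ ω, X.θstar ω) with hZdef
  have hZ : Measurable Z := hτs.prodMk (hτ.prodMk hθ)
  set q : Θ → ℝ := fun b => Q.real (τ ⁻¹' {b}) with hq
  set r : Θ → Θ → ℝ := fun a θ => Q.real ((fun ω => (τstar ω, X.θstar ω)) ⁻¹' {(a, θ)}) with hr
  have hqr : ∀ a b θ, Q.real (Z ⁻¹' {(a, b, θ)}) = q b * r a θ := fun a b θ => by
    have h := hind.measure_inter_preimage_eq_mul {b} {(a, θ)} (measurableSet_singleton _)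
      (measurableSet_singleton _)
    have h' : Z ⁻¹' {(a, b, θ)} =
        τ ⁻¹' {b} ∩ (fun ω => (τstar ω, X.θstar ω)) ⁻¹' {(a, θ)} := by
      ext ω; simp [Z]; tauto
    rw [h', measureReal_def, h, ENNReal.toReal_mul]; rfl
  have hqs : ∀ c, Q.real (τstar ⁻¹' {c}) = q c := fun c => by
    simp only [hq, measureReal_def]
    rw [← Measure.map_apply hτ (measurableSet_singleton c),
      ← Measure.map_apply hτs (measurableSet_singleton c), hlaw]
  have hq1 : ∑ b, q b = 1 := by
    have : IsProbabilityMeasure (Q.map τ) := Measure.isProbabilityMeasure_map hτ.aemeasurable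
    have h := sum_measureReal_singleton (μ := Q.map τ) Finset.univ
    simp only [Finset.coe_univ, probReal_univ] at h
    rw [← h]
    exact Finset.sum_congr rfl fun b _ => by
      simp only [hq, measureReal_def]
      rw [Measure.map_apply hτ (measurableSet_singleton b)]
  have hrq : ∀ c θ, q c = 0 → r c θ = 0 := fun c θ h => by
    refine le_antisymm ?_ measureReal_nonneg
    rw [← h, ← hqs]
    exact measureReal_mono fun ω hω => (Prod.ext_iff.1 hω).1
  have key : ∀ u : Θ × Θ × Θ → ℝ, ∀ f : Θ × Θ × Θ → Θ,
      ∫ ω, u (Z ω) * B.R (B.g (α (f (Z ω))) (X.θstar ω) (X.W t ω)) ∂Q =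
        ∑ a, ∑ b, ∑ θ, q b * r a θ * (u (a, b, θ) * B.mean (α (f (a, b, θ))) θ) := fun u f => by
    have h := hN.integral hW hZ u (fun z => α (f z)) (fun z => z.2.2)
    simp only [Fintype.sum_prod_type, hqr] at h
    exact h
  have hE1 : ∫ ω, B.R (B.outcome α X t τstar ω) ∂Q = ∑ c, ∑ θ, r c θ * B.mean (α c) θ := by
    have h := key (fun _ => 1) (fun z => z.1)
    simp only [one_mul] at h
    refine h.trans (Finset.sum_congr rfl fun a _ => ?_)
    rw [Finset.sum_comm]
    refine Finset.sum_congr rfl fun θ _ => ?_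
    simp_rw [mul_assoc]
    rw [← Finset.sum_mul, hq1, one_mul]
  have hE2 : ∫ ω, B.R (B.outcome α X t τ ω) ∂Q =
      ∑ c, q c * ∑ a, ∑ θ, r a θ * B.mean (α c) θ := by
    have h := key (fun _ => 1) (fun z => z.2.1)
    simp only [one_mul] at h
    refine h.trans ?_
    rw [Finset.sum_comm]
    simp_rw [Finset.mul_sum, mul_assoc]
  -- Independence of `τstar` from `(τ, Y)` is tested on the indicator of `τstar = c` against the
  -- indicator of `τ = c` times the reward. The two expectations are computed by `key`; a factor `q
  -- c` is common to both sides because `τ` and `τstar` have the same law.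
  have hc : ∀ c, q c * ∑ θ, r c θ * B.mean (α c) θ =
      q c * (q c * ∑ a, ∑ θ, r a θ * B.mean (α c) θ) := fun c => by
    let i : Θ → ℝ := fun x => if x = c then 1 else 0
    have hi : Measurable i := measurable_of_finite _
    have h1 := (hindep.comp hi ((hi.comp measurable_fst).mul
      (B.measurable_R.comp measurable_snd))).integral_fun_mul_eq_mul_integral
      (hi.comp hτs).aestronglyMeasurable
      (((hi.comp measurable_fst).mul (B.measurable_R.comp measurable_snd)).comp
        (hτ.prodMk hY)).aestronglyMeasurable
    have h2 := key (fun z => i z.1 * i z.2.1) (fun z => z.2.1)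
    have h3 := key (fun z => i z.2.1) (fun z => z.2.1)
    have h4 : ∫ ω, i (τstar ω) ∂Q = q c := by
      rw [← hqs, ← integral_indicator_one (hτs (measurableSet_singleton c))]
      refine integral_congr_ae (ae_of_all _ fun ω => ?_)
      by_cases h : τstar ω = c <;> simp [i, h]
    have h5 : q c * ∑ θ, r c θ * B.mean (α c) θ =
        ∫ ω, i (τstar ω) * i (τ ω) * B.R (B.g (α (τ ω)) (X.θstar ω) (X.W t ω)) ∂Q := by
      refine Eq.trans ?_ h2.symm
      rw [Finset.mul_sum, Finset.sum_eq_single (a := c) (s := Finset.univ) (f := fun a => ∑ b, ∑ θ, _),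
        Finset.sum_eq_single (a := c) (s := Finset.univ) (f := fun b => ∑ θ, _)]
      · refine Finset.sum_congr rfl fun θ _ => ?_
        simp only [i, if_true]; ring
      · intro b _ hb; simp [i, hb]
      · simp
      · intro b _ hb; simp [i, hb]
      · simp
    have h6 : q c * ∑ a, ∑ θ, r a θ * B.mean (α c) θ =
        ∫ ω, i (τ ω) * B.R (B.g (α (τ ω)) (X.θstar ω) (X.W t ω)) ∂Q := by
      refine Eq.trans ?_ h3.symm
      rw [Finset.mul_sum]
      refine Finset.sum_congr rfl fun a _ => ?_
      rw [Finset.mul_sum, Finset.sum_eq_single (a := c) (s := Finset.univ) (f := fun b => ∑ θ, _)]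
      · refine Finset.sum_congr rfl fun θ _ => ?_
        simp only [i, if_true]; ring
      · intro b _ hb; simp [i, hb]
      · simp
    rw [h5, h6, ← h4]
    simp_rw [mul_assoc]
    exact h1
  rw [integral_sub (B.integrable_R_comp hYs) (B.integrable_R_comp hY), hE1, hE2, sub_eq_zero]
  refine Finset.sum_congr rfl fun c _ => ?_
  -- If `τ` avoids `c`, so does `τstar`, and both terms vanish; otherwise the common factor cancels.
  by_cases h : q c = 0
  · simp [h, hrq c _ h]
  · exact mul_left_cancel₀ h (hc c)

/-- The target is informative on the sample and its outcome only through the statistic `ψ`. -/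
theorem mutualInfo_target_le {K : ℕ} {B : Bandit A Θ 𝒲 Y} {α : Θ → A}
    {Q : Measure Ω} [IsProbabilityMeasure Q] {X : Run Θ 𝒲 Ω} {t : ℕ} {τstar τ : Ω → Θ}
    (hθ : Measurable X.θstar) (hW : Measurable (X.W t)) (hτs : Measurable τstar)
    (hτ : Measurable τ) {ψ : Ω → Fin K} {c : Θ → Fin K} (hψ : ∀ ω, ψ ω = c (X.θstar ω))
    (hN : B.OutcomesIndep Q (X.W t) fun ω => (τstar ω, τ ω, X.θstar ω))
    (hcond : ∀ k, IndepFun τstar X.θstar (ProbabilityTheory.cond Q (ψ ⁻¹' {k})))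
    (hind : IndepFun τ (fun ω => (τstar ω, X.θstar ω)) Q) :
    mutualInfo Q τstar (fun ω => (τ ω, B.outcome α X t τ ω)) ≤
      mutualInfo Q ψ (fun ω => (τ ω, B.outcome α X t τ ω)) := by
  classical
  have : Fintype Θ := Fintype.ofFinite Θ
  have hY := B.measurable_outcome α hθ hW hτ
  have hψm : Measurable ψ := by
    have : ψ = c ∘ X.θstar := funext hψ
    rw [this]; exact (measurable_of_finite c).comp hθ
  have hV := hτ.prodMk hY
  have hs : ∀ {f : Ω → Θ}, Measurable f → ∀ x, MeasurableSet (f ⁻¹' {x}) := fun hf x =>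
    hf (measurableSet_singleton x)
  refine mutualInfo_le_of_cond_indep hψm hτs hV fun k a C hC => ?_
  have hk : MeasurableSet (ψ ⁻¹' {k}) := hψm (measurableSet_singleton k)
  let w : Θ → Θ → ℝ≥0∞ := fun b θ => B.ν (B.g (α b) θ ⁻¹' (Prod.mk b ⁻¹' C))
  -- Once the values `θ` and `b` are fixed, sample and noise factor out, and `τstar` enters only
  -- through its joint probability with `θstar`. The cases needed are `S = {a}` and `S = univ`.
  have hdec : ∀ S : Set Θ,
      Q (ψ ⁻¹' {k} ∩ τstar ⁻¹' S ∩ (fun ω => (τ ω, B.outcome α X t τ ω)) ⁻¹' C) =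
        ∑ θ, ∑ b, if c θ = k then Q (τ ⁻¹' {b}) * Q (τstar ⁻¹' S ∩ X.θstar ⁻¹' {θ}) * w b θ
          else 0 := fun S => by
    set V := ψ ⁻¹' {k} ∩ τstar ⁻¹' S ∩ (fun ω => (τ ω, B.outcome α X t τ ω)) ⁻¹' C with hVdef
    have hVm : MeasurableSet V := (hk.inter (hτs S.toFinite.measurableSet)).inter (hV hC)
    rw [measure_eq_sum_inter_preimage (hθ.prodMk hτ) hVm, Fintype.sum_prod_type]
    refine Finset.sum_congr rfl fun θ _ => Finset.sum_congr rfl fun b _ => ?_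
    split_ifs with hc
    · have h2 := hN.measure_inter hW {z | z.1 ∈ S ∧ z.2.1 = b ∧ z.2.2 = θ} (α b) θ
        (C := Prod.mk b ⁻¹' C) (measurable_prodMk_left hC)
      have h3 := hind.measure_inter_preimage_eq_mul {b} {z | z.1 ∈ S ∧ z.2 = θ}
        (measurableSet_singleton b) (Set.toFinite _).measurableSet
      have e3 : τ ⁻¹' {b} ∩ (fun ω => (τstar ω, X.θstar ω)) ⁻¹' {z | z.1 ∈ S ∧ z.2 = θ} =
          (fun ω => (τstar ω, τ ω, X.θstar ω)) ⁻¹' {z | z.1 ∈ S ∧ z.2.1 = b ∧ z.2.2 = θ} := by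
        ext ω; simp; tauto
      have e4 : (fun ω => (τstar ω, X.θstar ω)) ⁻¹' {z | z.1 ∈ S ∧ z.2 = θ} =
          τstar ⁻¹' S ∩ X.θstar ⁻¹' {θ} := rfl
      rw [e3, e4] at h3
      rw [← h3, ← h2]
      congr 1
      ext ω
      simp only [V, Set.mem_inter_iff, Set.mem_preimage, Set.mem_singleton_iff, hψ, outcome,
        Prod.mk.injEq, Set.mem_ofPred_eq]
      constructor
      · rintro ⟨⟨⟨-, hS⟩, hωC⟩, rfl, rfl⟩
        exact ⟨hωC, hS, rfl, rfl⟩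
      · rintro ⟨hωC, hS, rfl, rfl⟩
        exact ⟨⟨⟨hc, hS⟩, hωC⟩, rfl, rfl⟩
    · refine measure_mono_null (t := ∅) ?_ measure_empty
      rintro ω ⟨⟨⟨h1, -⟩, -⟩, h2⟩
      refine hc ?_
      have h3 : X.θstar ω = θ := (Prod.ext_iff.1 h2).1
      rw [← h3, ← hψ]; exact h1
  have hA := hdec {a}
  have hB := hdec Set.univ
  simp only [Set.preimage_univ, Set.inter_univ, Set.univ_inter] at hB
  rw [hA, hB, Finset.sum_mul, Finset.mul_sum]
  refine Finset.sum_congr rfl fun θ _ => ?_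
  rw [Finset.sum_mul, Finset.mul_sum]
  refine Finset.sum_congr rfl fun b _ => ?_
  split_ifs with hc
  swap; · simp
  -- Conditional independence of target and parameter given `ψ = k`, with denominators cleared.
  have hmk : Q (τstar ⁻¹' {a} ∩ X.θstar ⁻¹' {θ}) * Q (ψ ⁻¹' {k}) =
      Q (ψ ⁻¹' {k} ∩ τstar ⁻¹' {a}) * Q (X.θstar ⁻¹' {θ}) := by
    have hsub : X.θstar ⁻¹' {θ} ⊆ ψ ⁻¹' {k} := fun ω hω => by
      have : X.θstar ω = θ := hω
      simp [hψ, this, hc]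
    by_cases h0 : Q (ψ ⁻¹' {k}) = 0
    · rw [h0, mul_zero, measure_mono_null Set.inter_subset_left h0, zero_mul]
    have h := (hcond k).measure_inter_preimage_eq_mul {a} {θ} (measurableSet_singleton _)
      (measurableSet_singleton _)
    rw [cond_apply hk, cond_apply hk, cond_apply hk, Set.inter_eq_self_of_subset_right hsub,
      Set.inter_eq_self_of_subset_right (Set.inter_subset_right.trans hsub)] at h
    have h' := congrArg (fun x => Q (ψ ⁻¹' {k}) * Q (ψ ⁻¹' {k}) * x) h
    have hinv : Q (ψ ⁻¹' {k}) * (Q (ψ ⁻¹' {k}))⁻¹ = 1 :=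
      ENNReal.mul_inv_cancel h0 (measure_ne_top _ _)
    set x := Q (ψ ⁻¹' {k})
    calc Q (τstar ⁻¹' {a} ∩ X.θstar ⁻¹' {θ}) * x
        = (x * x⁻¹) * (x * Q (τstar ⁻¹' {a} ∩ X.θstar ⁻¹' {θ})) := by rw [hinv]; ring
      _ = x * x * (x⁻¹ * Q (τstar ⁻¹' {a} ∩ X.θstar ⁻¹' {θ})) := by ring
      _ = x * x * (x⁻¹ * Q (ψ ⁻¹' {k} ∩ τstar ⁻¹' {a}) * (x⁻¹ * Q (X.θstar ⁻¹' {θ}))) := h'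
      _ = (x * x⁻¹) * (x * x⁻¹) * (Q (ψ ⁻¹' {k} ∩ τstar ⁻¹' {a}) * Q (X.θstar ⁻¹' {θ})) := by
        ring
      _ = _ := by rw [hinv]; ring
  calc Q (τ ⁻¹' {b}) * Q (τstar ⁻¹' {a} ∩ X.θstar ⁻¹' {θ}) * w b θ * Q (ψ ⁻¹' {k})
      = Q (τ ⁻¹' {b}) * w b θ * (Q (τstar ⁻¹' {a} ∩ X.θstar ⁻¹' {θ}) * Q (ψ ⁻¹' {k})) := by ring
    _ = _ := by rw [hmk]; ring

end Bandit

/-- The tower property with one null set for all events of `V`: both sides are kernels into the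
countably generated `F`. -/
theorem ae_forall_setLIntegral_condExpKernel_eq {Ω F : Type*} {m₁ m₂ : MeasurableSpace Ω}
    [mΩ : MeasurableSpace Ω] [StandardBorelSpace Ω] {P : Measure Ω} [IsFiniteMeasure P]
    [MeasurableSpace F] [MeasurableSpace.CountablyGenerated F] (h₁₂ : m₁ ≤ m₂)
    (h₂ : m₂ ≤ mΩ) {s : Set Ω} (hs : MeasurableSet s) {V : Ω → F} (hV : Measurable[m₂] V) :
    ∀ᵐ ω ∂P, ∀ B, MeasurableSet B → condExpKernel P m₁ ω (s ∩ V ⁻¹' B) =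
      ∫⁻ ω' in V ⁻¹' B, condExpKernel P m₂ ω' s ∂(condExpKernel P m₁ ω) := by
  have hV' : Measurable V := hV.mono h₂ le_rfl
  have hD : Measurable fun ω => condExpKernel P m₂ ω s :=
    (measurable_condExpKernel hs).mono h₂ le_rfl
  let κ : Kernel Ω Ω := (condExpKernel P m₁).comap id (measurable_id'' (h₁₂.trans h₂))
  have hκ : ∀ ω, κ ω = condExpKernel P m₁ ω := fun ω => rfl
  let η₁ : Kernel Ω F := (κ.restrict hs).map V
  let η₂ : Kernel Ω F :=
    { toFun := fun ω => ((κ ω).withDensity fun ω' => condExpKernel P m₂ ω' s).map V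
      measurable' := Measure.measurable_of_measurable_coe _ fun B hB => by
        simp_rw [Measure.map_apply hV' hB, withDensity_apply _ (hV' hB),
          ← lintegral_indicator (hV' hB)]
        exact (hD.indicator (hV' hB)).lintegral_kernel }
  have e₁ : ∀ ω B, MeasurableSet B → η₁ ω B = condExpKernel P m₁ ω (s ∩ V ⁻¹' B) :=
    fun ω B hB => by
      simp only [η₁]
      rw [Kernel.map_apply _ hV', Kernel.restrict_apply, Measure.map_apply hV' hB,
        Measure.restrict_apply (hV' hB), Set.inter_comm, hκ]
  have e₂ : ∀ ω B, MeasurableSet B → η₂ ω B =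
      ∫⁻ ω' in V ⁻¹' B, condExpKernel P m₂ ω' s ∂(condExpKernel P m₁ ω) := fun ω B hB => by
    change (((κ ω).withDensity fun ω' => condExpKernel P m₂ ω' s).map V) B = _
    rw [Measure.map_apply hV' hB, withDensity_apply _ (hV' hB), hκ]
  have : IsFiniteKernel η₂ := ⟨⟨1, ENNReal.one_lt_top, fun ω => by
    rw [e₂ ω _ MeasurableSet.univ, Set.preimage_univ, Measure.restrict_univ]
    calc ∫⁻ ω', condExpKernel P m₂ ω' s ∂(condExpKernel P m₁ ω)
        ≤ ∫⁻ _, 1 ∂(condExpKernel P m₁ ω) := lintegral_mono fun _ => prob_le_one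
      _ = 1 := by simp⟩⟩
  have key := Kernel.ae_eq_of_forall_measurableSet (μ := P) (κ := η₁) (η := η₂) fun B hB => by
    filter_upwards [setLIntegral_condExpKernel_ae_eq (P := P) h₁₂ h₂ hs (hV hB)] with ω hω
    rw [e₁ ω B hB, e₂ ω B hB, hω]
  filter_upwards [key] with ω hω B hB
  rw [← e₁ ω B hB, ← e₂ ω B hB, hω]

/-! ### Conditional entropy of the cell along the history -/

namespace Bandit

variable {A Θ 𝒲 Y Ω : Type*} [MeasurableSpace Θ] [MeasurableSpace 𝒲] [MeasurableSpace Y]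
  [MeasurableSpace Ω] [StandardBorelSpace Ω]

/-- The conditional entropy of `ψ` given the history before period `t`. -/
noncomputable def condEntropy {K : ℕ} (B : Bandit A Θ 𝒲 Y) (α : Θ → A) (P : Measure Ω)
    [IsFiniteMeasure P] (X : Run Θ 𝒲 Ω) (ψ : Ω → Fin K) (t : ℕ) : ℝ :=
  ∑ k, ∫ ω, Real.negMulLog (B.posterior α P X t ω (ψ ⁻¹' {k})).toReal ∂P

instance (B : Bandit A Θ 𝒲 Y) (α : Θ → A) (P : Measure Ω) [IsFiniteMeasure P]
    (X : Run Θ 𝒲 Ω) (t : ℕ) (ω : Ω) : IsProbabilityMeasure (B.posterior α P X t ω) := by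
  unfold posterior; infer_instance

theorem condEntropy_nonneg {K : ℕ} (B : Bandit A Θ 𝒲 Y) (α : Θ → A) (P : Measure Ω)
    [IsFiniteMeasure P] (X : Run Θ 𝒲 Ω) (ψ : Ω → Fin K) (t : ℕ) :
    0 ≤ B.condEntropy α P X ψ t :=
  Finset.sum_nonneg fun _ _ => integral_nonneg fun _ =>
    Real.negMulLog_nonneg ENNReal.toReal_nonneg (by
      simpa using ENNReal.toReal_mono ENNReal.one_ne_top prob_le_one)

variable [Finite Θ] [MeasurableSingletonClass Θ]

theorem condEntropy_zero {K : ℕ} {B : Bandit A Θ 𝒲 Y} {α : Θ → A} {P : Measure Ω}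
    [IsProbabilityMeasure P] {X : Run Θ 𝒲 Ω} (hX : B.IsThompsonSampling α P X)
    {ψ : Ω → Fin K} (hψ : Measurable ψ) :
    B.condEntropy α P X ψ 0 = ∑ k, Real.negMulLog (P (ψ ⁻¹' {k})).toReal := by
  refine Finset.sum_congr rfl fun k _ => ?_
  have hs : MeasurableSet (ψ ⁻¹' {k}) := hψ (measurableSet_singleton k)
  have h : ∀ᵐ ω ∂P, B.posterior α P X 0 ω (ψ ⁻¹' {k}) = P (ψ ⁻¹' {k}) := by
    refine condExpKernel_apply_ae_eq (B.measurable_history α hX.measurable_θstar hX.measurable_W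
      hX.measurable_θ 0).comap_le hs measurable_const ?_
    rintro S ⟨C, -, rfl⟩
    -- Functions on `Fin 0` form a single point, so the initial history generates the trivial
    -- σ-algebra and the posterior is the prior.
    rcases Set.eq_empty_or_nonempty C with rfl | hC
    · simp
    · rw [Subsingleton.eq_univ_of_nonempty hC]; simp
  have h' : (fun ω => Real.negMulLog (B.posterior α P X 0 ω (ψ ⁻¹' {k})).toReal) =ᵐ[P]
      fun _ => Real.negMulLog (P (ψ ⁻¹' {k})).toReal := by
    filter_upwards [h] with ω hω
    rw [hω]
  rw [integral_congr_ae h']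
  simp

/-- What a period of Thompson sampling reveals about `ψ` is at most the decrease of its conditional
entropy. -/
theorem lintegral_mutualInfo_le_condEntropy_sub [MeasurableSpace.CountablyGenerated Y] {K : ℕ}
    {B : Bandit A Θ 𝒲 Y} {α : Θ → A} {P : Measure Ω} [IsProbabilityMeasure P] {X : Run Θ 𝒲 Ω}
    (hX : B.IsThompsonSampling α P X) {ψ : Ω → Fin K} (hψ : Measurable ψ) (t : ℕ) :
    0 ≤ B.condEntropy α P X ψ t - B.condEntropy α P X ψ (t + 1) ∧
    B.condMutualInfo α P X t ψ (fun ω => (X.θ t ω, B.outcome α X t (X.θ t) ω)) ≤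
      ENNReal.ofReal (B.condEntropy α P X ψ t - B.condEntropy α P X ψ (t + 1)) := by
  have hH := B.measurable_history α hX.measurable_θstar hX.measurable_W hX.measurable_θ
  have hmono : MeasurableSpace.comap (B.history α X t) inferInstance ≤
      MeasurableSpace.comap (B.history α X (t + 1)) inferInstance := by
    have : B.history α X t = (fun h s => h s.castSucc) ∘ B.history α X (t + 1) := rfl
    rw [this, ← MeasurableSpace.comap_comp]
    exact MeasurableSpace.comap_mono (Measurable.comap_le (by fun_prop))
  have hs : ∀ k, MeasurableSet (ψ ⁻¹' {k}) := fun k => hψ (measurableSet_singleton k)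
  have hV : Measurable[MeasurableSpace.comap (B.history α X (t + 1)) inferInstance]
      fun ω => (X.θ t ω, B.outcome α X t (X.θ t) ω) :=
    (measurable_pi_apply (Fin.last t)).comp (comap_measurable (B.history α X (t + 1)))
  have hmeas : ∀ s k, Measurable fun ω => B.posterior α P X s ω (ψ ⁻¹' {k}) := fun s k =>
    (measurable_condExpKernel (hs k)).mono (hH s).comap_le le_rfl
  have hint : ∀ s k, Integrable
      (fun ω => Real.negMulLog (B.posterior α P X s ω (ψ ⁻¹' {k})).toReal) P := fun s k =>
    integrable_negMulLog_toReal (hmeas s k) fun _ => prob_le_one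
  have hint' : ∀ k, Integrable (fun ω => ∫ ω', Real.negMulLog
      (B.posterior α P X (t + 1) ω' (ψ ⁻¹' {k})).toReal ∂(B.posterior α P X t ω)) P := fun k =>
    (hint (t + 1) k).integral_condExpKernel
  -- The entropy drop expected under the current posterior. It bounds the mutual information
  -- pointwise, and its mean is the drop of the conditional entropy.
  set G : Ω → ℝ := fun ω => ∑ k, (Real.negMulLog (B.posterior α P X t ω (ψ ⁻¹' {k})).toReal -
    ∫ ω', Real.negMulLog (B.posterior α P X (t + 1) ω' (ψ ⁻¹' {k})).toReal
      ∂(B.posterior α P X t ω))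
  have hint'' : ∀ k, Integrable (fun ω =>
      Real.negMulLog (B.posterior α P X t ω (ψ ⁻¹' {k})).toReal -
      ∫ ω', Real.negMulLog (B.posterior α P X (t + 1) ω' (ψ ⁻¹' {k})).toReal
      ∂(B.posterior α P X t ω)) P := fun k => (hint t k).sub (hint' k)
  have hGi : Integrable G P := integrable_finsetSum _ fun k _ => hint'' k
  have hGint : ∫ ω, G ω ∂P = B.condEntropy α P X ψ t - B.condEntropy α P X ψ (t + 1) := by
    rw [integral_finsetSum _ fun k _ => hint'' k, condEntropy, condEntropy,
      ← Finset.sum_sub_distrib]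
    refine Finset.sum_congr rfl fun k _ => ?_
    rw [integral_sub (hint t k) (hint' k)]
    congr 1
    exact integral_integral_condExpKernel (hH t).comap_le (hint (t + 1) k)
  have key : ∀ᵐ ω ∂P, 0 ≤ G ω ∧ mutualInfo (B.posterior α P X t ω) ψ
      (fun ω => (X.θ t ω, B.outcome α X t (X.θ t) ω)) ≤ ENNReal.ofReal (G ω) := by
    filter_upwards [ae_all_iff.2 fun k => ae_forall_setLIntegral_condExpKernel_eq (P := P)
      hmono (hH (t + 1)).comap_le (hs k) hV] with ω hω
    exact mutualInfo_le_entropy_sub hψ (hV.mono (hH (t + 1)).comap_le le_rfl)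
      (hmeas (t + 1)) (fun _ _ => prob_le_one) hω
  have hnn : 0 ≤ᵐ[P] G := by filter_upwards [key] with ω hω using hω.1
  rw [← hGint]
  refine ⟨integral_nonneg_of_ae hnn, ?_⟩
  rw [ofReal_integral_eq_lintegral_ofReal hGi hnn]
  exact lintegral_mono_ae (by filter_upwards [key] with ω hω using hω.2)

/-- Needed to conclude that the mutual information vanishes almost everywhere when its mean does. -/
theorem measurable_mutualInfo_posterior [MeasurableSpace.CountablyGenerated Y]
    {B : Bandit A Θ 𝒲 Y} {α : Θ → A} {P : Measure Ω} [IsProbabilityMeasure P] {X : Run Θ 𝒲 Ω}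
    (hX : B.IsThompsonSampling α P X) (t : ℕ) {U : Ω → Θ} {V : Ω → Θ × Y} (hU : Measurable U)
    (hV : Measurable V) : Measurable fun ω => mutualInfo (B.posterior α P X t ω) U V := by
  have hH := B.measurable_history α hX.measurable_θstar hX.measurable_W hX.measurable_θ t
  let κ : Kernel Ω Ω := (condExpKernel P (MeasurableSpace.comap (B.history α X t)
    inferInstance)).comap id (measurable_id'' hH.comap_le)
  have hκ : ∀ ω, κ ω = B.posterior α P X t ω := fun ω => rfl
  have h := measurable_klDiv_kernel (κ.map fun ω => (U ω, V ω)) ((κ.map U) ×ₖ (κ.map V))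
  simp_rw [Kernel.prod_apply, Kernel.map_apply _ hU, Kernel.map_apply _ hV,
    Kernel.map_apply _ (hU.prodMk hV), hκ] at h
  exact h

/-! ### The regret bound -/

section Bound

variable {K : ℕ} {B : Bandit A Θ 𝒲 Y}
  {α : Θ → A} {P : Measure Ω} [IsProbabilityMeasure P] {X : Run Θ 𝒲 Ω} {ψ : Ω → Fin K} {ε : ℝ}
  {t : ℕ} {τstar τ : Ω → Θ}

theorem IsCompressed.integral_regret_le (h : B.IsCompressed α P X ψ ε t τstar τ)
    (hX : B.IsThompsonSampling α P X) :
    ∫ ω, (B.bestReward α X ω - B.R (B.outcome α X t (X.θ t) ω)) ∂P ≤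
      ∫ ω, (B.R (B.outcome α X t τstar ω) - B.R (B.outcome α X t τ ω)) ∂P + ε := by
  have hH := B.measurable_history α hX.measurable_θstar hX.measurable_W hX.measurable_θ t
  have hYm : ∀ {ϑ : Ω → Θ}, Measurable ϑ → Measurable (B.outcome α X t ϑ) := fun hϑ =>
    B.measurable_outcome α hX.measurable_θstar (hX.measurable_W t) hϑ
  have hi₁ : Integrable (fun ω => B.bestReward α X ω - B.R (B.outcome α X t (X.θ t) ω)) P :=
    (B.integrable_bestReward α hX.measurable_θstar).sub
      (B.integrable_R_comp (hYm (hX.measurable_θ t)))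
  have hi₂ : Integrable (fun ω => B.R (B.outcome α X t τstar ω) - B.R (B.outcome α X t τ ω)) P :=
    (B.integrable_R_comp (hYm h.measurable_target)).sub
      (B.integrable_R_comp (hYm h.measurable_sample))
  rw [← integral_integral_condExpKernel hH.comap_le hi₁,
    ← integral_integral_condExpKernel hH.comap_le hi₂]
  have hle := integral_mono_ae (hi₁.integral_condExpKernel.sub hi₂.integral_condExpKernel)
    (integrable_const ε) h.regret_le
  rw [integral_const, probReal_univ, one_smul] at hle
  have hsub := integral_sub (hi₁.integral_condExpKernel (m := MeasurableSpace.comap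
    (B.history α X t) inferInstance)) (hi₂.integral_condExpKernel (m := MeasurableSpace.comap
    (B.history α X t) inferInstance))
  have := hsub.symm.trans_le hle
  linarith

theorem condEntropy_zero_le_mutualInfo (hX : B.IsThompsonSampling α P X) {c : Θ → Fin K}
    (hc : ∀ ω, ψ ω = c (X.θstar ω)) :
    B.condEntropy α P X ψ 0 ≤ (mutualInfo P X.θstar ψ).toReal := by
  have hψc : ψ = c ∘ X.θstar := funext hc
  have hcm : Measurable c := measurable_of_finite c
  have hψ : Measurable ψ := hψc ▸ hcm.comp hX.measurable_θstar
  have hlow : mutualInfo P ψ ψ ≤ mutualInfo P X.θstar ψ := by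
    have := mutualInfo_comp_left_le (P := P) hX.measurable_θstar hψ hcm
    rwa [← hψc] at this
  -- Since `toReal` sends `∞` to `0`, finiteness is essential. It holds because `ψ` has finitely
  -- many values: the indicators of its cells serve as conditional probabilities.
  have htop : mutualInfo P X.θstar ψ ≠ ∞ := by
    refine ne_top_of_le_ne_top ?_ (mutualInfo_comm_le hX.measurable_θstar hψ)
    have hs : ∀ k, MeasurableSet (ψ ⁻¹' {k}) := fun k => hψ (measurableSet_singleton k)
    refine ne_top_of_le_ne_top ENNReal.ofReal_ne_top (mutualInfo_le_entropy_sub (Q := P) hψ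
      hX.measurable_θstar (D := fun k => (ψ ⁻¹' {k}).indicator 1)
      (fun k => measurable_one.indicator (hs k))
      (fun k x => Set.indicator_le_self' (fun _ _ => zero_le) x) fun k C hC => ?_).2
    rw [lintegral_indicator_one (hs k), Measure.restrict_apply (hs k)]
  rw [condEntropy_zero hX hψ]
  rw [mutualInfo_self hψ] at hlow
  exact (ENNReal.ofReal_le_iff_le_toReal htop).1 hlow

variable [Finite A] [MeasurableSpace.CountablyGenerated Y]

theorem IsCompressed.ae_outcomesIndep (h : B.IsCompressed α P X ψ ε t τstar τ)
    (hX : B.IsThompsonSampling α P X) :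
    ∀ᵐ ω ∂P, B.OutcomesIndep (B.posterior α P X t ω) (X.W t)
      fun ω => (τstar ω, τ ω, X.θstar ω) := by
  refine Bandit.ae_outcomesIndep hX
    (h.measurable_target.prodMk (h.measurable_sample.prodMk hX.measurable_θstar)) ?_
  have hm : Measurable fun p : Θ × (Fin t → Θ × Y) × Θ × Θ =>
      ((p.2.2.1, p.2.2.2, p.1), p.2.1) := by fun_prop
  exact h.noise_indep.comp measurable_id hm

theorem IsCompressed.condMutualInfo_le (h : B.IsCompressed α P X ψ ε t τstar τ)
    (hX : B.IsThompsonSampling α P X) {c : Θ → Fin K} (hc : ∀ ω, ψ ω = c (X.θstar ω)) :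
    B.condMutualInfo α P X t τstar (fun ω => (τ ω, B.outcome α X t τ ω)) ≤
      B.condMutualInfo α P X t ψ (fun ω => (X.θ t ω, B.outcome α X t (X.θ t) ω)) := by
  refine lintegral_mono_ae ?_
  filter_upwards [h.ae_outcomesIndep hX, h.target_indep, h.sample_indep, h.info_le]
    with ω h1 h2 h3 h4
  exact (mutualInfo_target_le hX.measurable_θstar (hX.measurable_W t) h.measurable_target
    h.measurable_sample hc h1 h2 h3).trans h4

theorem IsCompressed.integral_sub_eq_zero (h : B.IsCompressed α P X ψ ε t τstar τ)
    (hX : B.IsThompsonSampling α P X)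
    (h0 : B.condMutualInfo α P X t τstar (fun ω => (τ ω, B.outcome α X t τ ω)) = 0) :
    ∫ ω, (B.R (B.outcome α X t τstar ω) - B.R (B.outcome α X t τ ω)) ∂P = 0 := by
  have hH := B.measurable_history α hX.measurable_θstar hX.measurable_W hX.measurable_θ t
  have hYs := B.measurable_outcome α hX.measurable_θstar (hX.measurable_W t) h.measurable_target
  have hY := B.measurable_outcome α hX.measurable_θstar (hX.measurable_W t) h.measurable_sample
  have h0' := (lintegral_eq_zero_iff (measurable_mutualInfo_posterior hX t h.measurable_target
    (h.measurable_sample.prodMk hY))).1 h0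
  have hi : Integrable (fun ω => B.R (B.outcome α X t τstar ω) - B.R (B.outcome α X t τ ω)) P :=
    (B.integrable_R_comp hYs).sub (B.integrable_R_comp hY)
  rw [← integral_integral_condExpKernel hH.comap_le hi]
  refine integral_eq_zero_of_ae ?_
  filter_upwards [h0', h.ae_outcomesIndep hX, h.sample_law, h.sample_indep] with ω h1 h2 h3 h4
  exact integral_sub_eq_zero_of_mutualInfo_eq_zero hX.measurable_θstar (hX.measurable_W t)
    h.measurable_target h.measurable_sample h2 h3 h4 h1

theorem IsCompressed.sq_integral_le (h : B.IsCompressed α P X ψ ε t τstar τ)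
    (hX : B.IsThompsonSampling α P X) {c : Θ → Fin K} (hc : ∀ ω, ψ ω = c (X.θstar ω)) :
    (∫ ω, (B.R (B.outcome α X t τstar ω) - B.R (B.outcome α X t τ ω)) ∂P) ^ 2 ≤
      B.infoRatio α P X t τstar τ *
        (B.condEntropy α P X ψ t - B.condEntropy α P X ψ (t + 1)) := by
  have hψ : Measurable ψ := by
    rw [show ψ = c ∘ X.θstar from funext hc]
    exact (measurable_of_finite c).comp hX.measurable_θstar
  obtain ⟨hnn, hle⟩ := lintegral_mutualInfo_le_condEntropy_sub hX hψ t
  have hI := (h.condMutualInfo_le hX hc).trans hle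
  have hIr := ENNReal.toReal_le_of_le_ofReal hnn hI
  have hratio : 0 ≤ B.infoRatio α P X t τstar τ :=
    div_nonneg (sq_nonneg _) ENNReal.toReal_nonneg
  -- A zero denominator makes the ratio `0`, so the gap itself must vanish. The other source of a
  -- zero `toReal`, the value `∞`, is excluded by `hI`.
  by_cases h0 : (B.condMutualInfo α P X t τstar
      (fun ω => (τ ω, B.outcome α X t τ ω))).toReal = 0
  · have h0' := (ENNReal.toReal_eq_zero_iff _).1 h0 |>.resolve_right
      (ne_top_of_le_ne_top ENNReal.ofReal_ne_top hI)
    rw [h.integral_sub_eq_zero hX h0']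
    simpa using mul_nonneg hratio hnn
  · refine le_trans (le_of_eq ?_) (mul_le_mul_of_nonneg_left hIr hratio)
    rw [infoRatio, div_mul_cancel₀ _ h0]

theorem bayesRegret_le (hX : B.IsThompsonSampling α P X) {c : Θ → Fin K}
    (hc : ∀ ω, ψ ω = c (X.θstar ω)) (T : ℕ) (τstar τ : ℕ → Ω → Θ)
    (h : ∀ t < T, B.IsCompressed α P X ψ ε t (τstar t) (τ t)) :
    B.bayesRegret α P X T ≤
      Real.sqrt ((⨆ t : Fin T, B.infoRatio α P X t (τstar t) (τ t)) *
        (mutualInfo P X.θstar ψ).toReal * T) + ε * T := by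
  set Γ := ⨆ t : Fin T, B.infoRatio α P X t (τstar t) (τ t) with hΓ
  set Δ : ℕ → ℝ := fun t =>
    ∫ ω, (B.R (B.outcome α X t (τstar t) ω) - B.R (B.outcome α X t (τ t) ω)) ∂P with hΔ
  have hψ : Measurable ψ := by
    rw [show ψ = c ∘ X.θstar from funext hc]
    exact (measurable_of_finite c).comp hX.measurable_θstar
  have hΓnn : 0 ≤ Γ := Real.iSup_nonneg fun t => div_nonneg (sq_nonneg _) ENNReal.toReal_nonneg
  have hle : ∀ t < T, B.infoRatio α P X t (τstar t) (τ t) ≤ Γ := fun t ht =>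
    le_ciSup (f := fun t : Fin T => B.infoRatio α P X t (τstar t) (τ t))
      (Set.finite_range _).bddAbove ⟨t, ht⟩
  have hreg : B.bayesRegret α P X T ≤ ∑ t ∈ Finset.range T, Δ t + ε * T := by
    have hi : ∀ t, Integrable
        (fun ω => B.bestReward α X ω - B.R (B.outcome α X t (X.θ t) ω)) P := fun t =>
      (B.integrable_bestReward α hX.measurable_θstar).sub (B.integrable_R_comp
        (B.measurable_outcome α hX.measurable_θstar (hX.measurable_W t) (hX.measurable_θ t)))
    rw [bayesRegret, integral_finsetSum _ fun t _ => hi t]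
    calc _ ≤ ∑ t ∈ Finset.range T, (Δ t + ε) := Finset.sum_le_sum fun t ht =>
          (h t (Finset.mem_range.1 ht)).integral_regret_le hX
      _ = _ := by rw [Finset.sum_add_distrib]; simp [mul_comm]
  refine hreg.trans (add_le_add_left (Real.le_sqrt_of_sq_le ?_) _)
  -- Cauchy–Schwarz, then the one-period bounds, whose entropy drops telescope; the final entropy is
  -- nonnegative and is discarded.
  calc (∑ t ∈ Finset.range T, Δ t) ^ 2
      ≤ T * ∑ t ∈ Finset.range T, Δ t ^ 2 := by
        simpa using sq_sum_le_card_mul_sum_sq (s := Finset.range T) (f := Δ)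
    _ ≤ T * ∑ t ∈ Finset.range T,
          Γ * (B.condEntropy α P X ψ t - B.condEntropy α P X ψ (t + 1)) := by
        refine mul_le_mul_of_nonneg_left (Finset.sum_le_sum fun t ht => ?_) (Nat.cast_nonneg T)
        have ht' := Finset.mem_range.1 ht
        exact ((h t ht').sq_integral_le hX hc).trans (mul_le_mul_of_nonneg_right (hle t ht')
          (lintegral_mutualInfo_le_condEntropy_sub hX hψ t).1)
    _ = T * (Γ * (B.condEntropy α P X ψ 0 - B.condEntropy α P X ψ T)) := by
        rw [← Finset.mul_sum, Finset.sum_range_sub']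
    _ ≤ T * (Γ * (mutualInfo P X.θstar ψ).toReal) := by
        have h1 := B.condEntropy_nonneg α P X ψ T
        have h2 := condEntropy_zero_le_mutualInfo hX hc
        gcongr
        linarith
    _ = Γ * (mutualInfo P X.θstar ψ).toReal * T := by ring

end Bound

end Bandit

/-! ### Enlarging the sample space -/

section Extension

/-- On `m`, the posterior probability of `s` is the density of `P` restricted to `s` with respect to
`P`. -/
theorem setLIntegral_mul_condExpKernel {Ω : Type*} {m : MeasurableSpace Ω}
    [mΩ : MeasurableSpace Ω] [StandardBorelSpace Ω] {P : Measure Ω} [IsFiniteMeasure P]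
    (hm : m ≤ mΩ) {s A : Set Ω} (hs : MeasurableSet s) (hA : MeasurableSet[m] A)
    {h : Ω → ℝ≥0∞} (hh : Measurable[m] h) :
    ∫⁻ ω in A, h ω * condExpKernel P m ω s ∂P = ∫⁻ ω in s ∩ A, h ω ∂P := by
  have hκ : Measurable[m] fun ω => condExpKernel P m ω s := measurable_condExpKernel hs
  have hdens : (P.restrict s).trim hm = (P.trim hm).withDensity fun ω => condExpKernel P m ω s := by
    refine @Measure.ext _ m _ _ fun C hC => ?_
    rw [trim_measurableSet_eq hm hC, Measure.restrict_apply (hm _ hC),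
      @withDensity_apply _ m _ _ _ hC, restrict_trim hm P hC, lintegral_trim hm hκ,
      setLIntegral_condExpKernel hm hs hC, Set.inter_comm]
  have hhA : Measurable[m] (A.indicator h) := hh.indicator hA
  have h1 : ∫⁻ ω in s ∩ A, h ω ∂P = ∫⁻ ω, A.indicator h ω ∂((P.restrict s).trim hm) := by
    rw [lintegral_trim hm hhA, lintegral_indicator (hm _ hA), Measure.restrict_restrict (hm _ hA),
      Set.inter_comm]
  rw [h1, hdens, @lintegral_withDensity_eq_lintegral_mul _ m _ _ hκ _ hhA,
    lintegral_trim hm (hκ.mul hhA), ← lintegral_indicator (hm _ hA)]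
  refine lintegral_congr fun ω => ?_
  by_cases hω : ω ∈ A <;> simp [hω, mul_comm]

theorem ProbabilityTheory.IndepFun.comp_measurePreserving {Ω Ω' E F : Type*} [MeasurableSpace Ω]
    [MeasurableSpace Ω'] [MeasurableSpace E] [MeasurableSpace F] {P : Measure Ω} {P' : Measure Ω'}
    {φ : Ω' → Ω} (hφ : MeasurePreserving φ P' P) {f : Ω → E} {g : Ω → F} (hf : Measurable f)
    (hg : Measurable g) (h : IndepFun f g P) : IndepFun (f ∘ φ) (g ∘ φ) P' := by
  rw [indepFun_iff_measure_inter_preimage_eq_mul] at h ⊢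
  intro s t hs ht
  have h' := h s t hs ht
  rw [← hφ.measure_preimage ((hf hs).inter (hg ht)).nullMeasurableSet,
    ← hφ.measure_preimage (hf hs).nullMeasurableSet,
    ← hφ.measure_preimage (hg ht).nullMeasurableSet] at h'
  exact h'

/-- By associativity of products, an independent coordinate may join either side of an independence.
This keeps the noise independent of a target built from the auxiliary variable. -/
theorem ProbabilityTheory.IndepFun.prodMk_snd {Ω S E F : Type*} [MeasurableSpace Ω]
    [MeasurableSpace S] [MeasurableSpace E] [MeasurableSpace F] {P : Measure Ω} {U : Measure S}
    [IsProbabilityMeasure P] [IsProbabilityMeasure U] {f : Ω → E} {g : Ω → F} (hf : Measurable f)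
    (hg : Measurable g) (h : IndepFun f g P) :
    IndepFun (fun x : Ω × S => f x.1) (fun x : Ω × S => (g x.1, x.2)) (P.prod U) := by
  rw [indepFun_iff_map_prod_eq_prod_map_map (by fun_prop) (by fun_prop)]
  rw [indepFun_iff_map_prod_eq_prod_map_map hf.aemeasurable hg.aemeasurable] at h
  have e1 : (P.prod U).map (fun x : Ω × S => (g x.1, x.2)) = (P.map g).prod U := by
    have := Measure.map_prod_map P U hg measurable_id
    rw [Measure.map_id] at this
    exact this.symm
  have e2 : (P.prod U).map (fun x : Ω × S => f x.1) = P.map f := by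
    have h' : (fun x : Ω × S => f x.1) = f ∘ Prod.fst := rfl
    rw [h', ← Measure.map_map hf measurable_fst, Measure.map_fst_prod]
    simp
  have e3 : (P.prod U).map (fun x : Ω × S => ((f x.1, g x.1), x.2)) =
      (P.map fun ω => (f ω, g ω)).prod U := by
    have := Measure.map_prod_map P U (hf.prodMk hg) measurable_id
    rw [Measure.map_id] at this
    exact this.symm
  have : IsProbabilityMeasure (P.map f) := Measure.isProbabilityMeasure_map hf.aemeasurable
  have : IsProbabilityMeasure (P.map g) := Measure.isProbabilityMeasure_map hg.aemeasurable
  rw [e1, e2, ← Measure.prodAssoc_prod, ← h, ← e3,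
    Measure.map_map MeasurableEquiv.prodAssoc.measurable (by fun_prop)]
  rfl

theorem ProbabilityTheory.indepFun_of_forall_singleton {Ω E F : Type*} [MeasurableSpace Ω]
    [MeasurableSpace E] [MeasurableSpace F] [Countable E] [Countable F]
    [MeasurableSingletonClass E] [MeasurableSingletonClass F] {Q : Measure Ω} [IsFiniteMeasure Q]
    {f : Ω → E} {g : Ω → F} (hf : Measurable f) (hg : Measurable g)
    (h : ∀ a b, Q (f ⁻¹' {a} ∩ g ⁻¹' {b}) = Q (f ⁻¹' {a}) * Q (g ⁻¹' {b})) : IndepFun f g Q := by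
  rw [indepFun_iff_map_prod_eq_prod_map_map hf.aemeasurable hg.aemeasurable]
  refine Measure.ext_of_singleton fun p => ?_
  have hp : ({p} : Set (E × F)) = {p.1} ×ˢ {p.2} := by simp
  rw [hp, Measure.prod_prod, Measure.map_apply hf (measurableSet_singleton _),
    Measure.map_apply hg (measurableSet_singleton _), ← h,
    Measure.map_apply (hf.prodMk hg) ((measurableSet_singleton _).prod (measurableSet_singleton _))]
  rfl

variable {Ω Ω' G : Type*} [MeasurableSpace Ω] [StandardBorelSpace Ω] [MeasurableSpace Ω']
  [StandardBorelSpace Ω'] [MeasurableSpace G] {P : Measure Ω} [IsFiniteMeasure P] {P' : Measure Ω'}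
  [IsFiniteMeasure P'] {φ : Ω' → Ω} {H : Ω → G}

/-- A measure-preserving extension adds nothing to the history, so events of the original space keep
their posterior probabilities. -/
theorem condExpKernel_preimage_ae_eq (hφ : MeasurePreserving φ P' P) (hH : Measurable H)
    {s : Set Ω} (hs : MeasurableSet s) :
    ∀ᵐ ω ∂P', condExpKernel P' (MeasurableSpace.comap (H ∘ φ) inferInstance) ω (φ ⁻¹' s) =
      condExpKernel P (MeasurableSpace.comap H inferInstance) (φ ω) s := by
  refine condExpKernel_apply_ae_eq (hH.comp hφ.measurable).comap_le (hφ.measurable hs) ?_ ?_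
  · rw [← MeasurableSpace.comap_comp]
    exact (measurable_condExpKernel hs).comp (comap_measurable φ)
  · rintro _ ⟨C, hC, rfl⟩
    have hm := hH.comap_le
    have hk : Measurable fun ω => condExpKernel P (MeasurableSpace.comap H inferInstance) ω s :=
      (measurable_condExpKernel hs).mono hm le_rfl
    have h := hφ.setLIntegral_comp_preimage (hH hC) hk
    rw [setLIntegral_condExpKernel hm hs ⟨C, hC, rfl⟩,
      ← hφ.measure_preimage (hs.inter (hH hC)).nullMeasurableSet] at h
    exact h

theorem map_condExpKernel_comp_ae_eq {E : Type*} [Countable E] [MeasurableSpace E]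
    [MeasurableSingletonClass E] (hφ : MeasurePreserving φ P' P) (hH : Measurable H) {f : Ω → E}
    (hf : Measurable f) :
    ∀ᵐ ω ∂P', (condExpKernel P' (MeasurableSpace.comap (H ∘ φ) inferInstance) ω).map (f ∘ φ) =
      (condExpKernel P (MeasurableSpace.comap H inferInstance) (φ ω)).map f := by
  filter_upwards [ae_all_iff.2 fun a => condExpKernel_preimage_ae_eq hφ hH
    (hf (measurableSet_singleton a))] with ω hω
  refine Measure.ext_of_singleton fun a => ?_
  rw [Measure.map_apply (hf.comp hφ.measurable) (measurableSet_singleton a),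
    Measure.map_apply hf (measurableSet_singleton a), ← hω a]
  rfl

end Extension

/-! ### Fresh draws given the cell and the history -/

section Resampling

variable {Ω S G Θ : Type*} [MeasurableSpace Ω] [StandardBorelSpace Ω] [MeasurableSpace S]
  [StandardBorelSpace S] [MeasurableSpace G] [MeasurableSpace Θ]
  [MeasurableSingletonClass Θ] {P : Measure Ω} [IsProbabilityMeasure P] {U : Measure S}
  [IsProbabilityMeasure U] {K : ℕ} {ψ : Ω → Fin K} {H : Ω → G}

/-- The law, given the history `H`, of a variable that is drawn from the law `q` indexed by the
values of `ψ` and `H`. -/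
theorem condExpKernel_resample_ae_eq (hψ : Measurable ψ) (hH : Measurable H)
    (q : Kernel (Fin K × G) Θ) {f : Fin K × G → S → Θ} (hf : Measurable (Function.uncurry f))
    (hfq : ∀ x, U.map (f x) = q x) (k : Fin K) (a : Θ) {s : Set Ω} (hs : MeasurableSet s) :
    ∀ᵐ x ∂(P.prod U), condExpKernel (P.prod U) (MeasurableSpace.comap (H ∘ Prod.fst) inferInstance) x
        ((fun x : Ω × S => f (ψ x.1, H x.1) x.2) ⁻¹' {a} ∩ Prod.fst ⁻¹' (s ∩ ψ ⁻¹' {k})) =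
      q (k, H x.1) {a} *
        condExpKernel P (MeasurableSpace.comap H inferInstance) x.1 (s ∩ ψ ⁻¹' {k}) := by
  have hτ : Measurable fun x : Ω × S => f (ψ x.1, H x.1) x.2 := by
    have : Measurable fun x : Ω × S => ((ψ x.1, H x.1), x.2) := by fun_prop
    exact hf.comp this
  have ha := measurableSet_singleton a
  have hsk : MeasurableSet (s ∩ ψ ⁻¹' {k}) := hs.inter (hψ (measurableSet_singleton k))
  have hφ : MeasurePreserving (Prod.fst : Ω × S → Ω) (P.prod U) P := measurePreserving_fst
  have hm := hH.comap_le
  have hq : Measurable[MeasurableSpace.comap H inferInstance] fun ω => q (k, H ω) {a} :=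
    ((q.measurable_coe ha).comp measurable_prodMk_left).comp (comap_measurable H)
  have hκ : Measurable[MeasurableSpace.comap H inferInstance] fun ω =>
      condExpKernel P (MeasurableSpace.comap H inferInstance) ω (s ∩ ψ ⁻¹' {k}) :=
    measurable_condExpKernel hsk
  refine condExpKernel_apply_ae_eq (hH.comp measurable_fst).comap_le
    ((hτ ha).inter (measurable_fst hsk)) ?_ ?_
  · rw [← MeasurableSpace.comap_comp]
    exact (hq.mul hκ).comp (comap_measurable Prod.fst)
  · rintro _ ⟨C, hC, rfl⟩
    have h1 := hφ.setLIntegral_comp_preimage (hH hC) ((hq.mul hκ).mono hm le_rfl)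
    refine h1.trans ?_
    refine (setLIntegral_mul_condExpKernel hm hsk ⟨C, hC, rfl⟩ hq).trans ?_
    have hD : MeasurableSet (s ∩ ψ ⁻¹' {k} ∩ H ⁻¹' C) := hsk.inter (hH hC)
    have e : (fun x : Ω × S => f (ψ x.1, H x.1) x.2) ⁻¹' {a} ∩ Prod.fst ⁻¹' (s ∩ ψ ⁻¹' {k}) ∩
        (H ∘ Prod.fst) ⁻¹' C =
        (fun x : Ω × S => f (ψ x.1, H x.1) x.2) ⁻¹' {a} ∩
          Prod.fst ⁻¹' (s ∩ ψ ⁻¹' {k} ∩ H ⁻¹' C) := by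
      ext; simp; tauto
    -- Fubini: over each `ω` of the event, the section in the auxiliary variable has measure `q (k,
    -- H ω) {a}`.
    rw [e, Measure.prod_apply ((hτ ha).inter (measurable_fst hD)), ← lintegral_indicator hD]
    refine lintegral_congr fun ω => ?_
    by_cases hω : ω ∈ s ∩ ψ ⁻¹' {k} ∩ H ⁻¹' C
    · rw [Set.indicator_of_mem hω, ← hfq, Measure.map_apply hf.of_uncurry_left ha]
      congr 1
      ext u
      have hω' : (ω ∈ s ∧ ψ ω = k) ∧ H ω ∈ C := hω
      simp [hω']
    · rw [Set.indicator_of_notMem hω]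
      symm
      refine measure_mono_null (t := ∅) (fun u hu => hω hu.2) measure_empty

/-- Given the history, the conditional law of `V` given `ψ` and the history is a conditional law
of `V` given `ψ`. -/
theorem condDistrib_mul_condExpKernel_ae_eq [Countable Θ] [Nonempty Θ] (hψ : Measurable ψ) (hH : Measurable H)
    {V : Ω → Θ} (hV : Measurable V) (k : Fin K) (a : Θ) :
    ∀ᵐ ω ∂P, condExpKernel P (MeasurableSpace.comap H inferInstance) ω
        (V ⁻¹' {a} ∩ ψ ⁻¹' {k}) =
      condDistrib V (fun ω => (ψ ω, H ω)) P (k, H ω) {a} *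
        condExpKernel P (MeasurableSpace.comap H inferInstance) ω (ψ ⁻¹' {k}) := by
  have hm := hH.comap_le
  have ha := measurableSet_singleton a
  have hk : MeasurableSet (ψ ⁻¹' {k}) := hψ (measurableSet_singleton k)
  have hq : Measurable[MeasurableSpace.comap H inferInstance] fun ω =>
      condDistrib V (fun ω => (ψ ω, H ω)) P (k, H ω) {a} :=
    (((condDistrib V (fun ω => (ψ ω, H ω)) P).measurable_coe ha).comp
      measurable_prodMk_left).comp (comap_measurable H)
  refine condExpKernel_apply_ae_eq hm ((hV ha).inter hk) (hq.mul (measurable_condExpKernel hk)) ?_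
  rintro _ ⟨C, hC, rfl⟩
  refine (setLIntegral_mul_condExpKernel hm hk ⟨C, hC, rfl⟩ hq).trans ?_
  have h := setLIntegral_preimage_condDistrib (μ := P) (hψ.prodMk hH) hV.aemeasurable ha
    ((measurableSet_singleton k).prod hC)
  have e : (fun ω => (ψ ω, H ω)) ⁻¹' ({k} ×ˢ C) = ψ ⁻¹' {k} ∩ H ⁻¹' C := rfl
  rw [e] at h
  rw [Set.inter_assoc, Set.inter_comm (V ⁻¹' {a}), ← h]
  refine setLIntegral_congr_fun (hk.inter (hH hC)) fun ω hω => ?_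
  have : ψ ω = k := hω.1
  simp only [this]

end Resampling

/-! ### Existence of compressed steps -/

namespace Bandit

variable {A Θ 𝒲 Y Ω : Type*} [Finite Θ] [MeasurableSpace Θ] [MeasurableSingletonClass Θ]
  [MeasurableSpace 𝒲] [MeasurableSpace Y] [MeasurableSpace Ω] [StandardBorelSpace Ω]
  {B : Bandit A Θ 𝒲 Y} {α : Θ → A} {P : Measure Ω} [IsProbabilityMeasure P] {X : Run Θ 𝒲 Ω}

theorem IsThompsonSampling.lift {Ω' : Type*} [MeasurableSpace Ω'] [StandardBorelSpace Ω']
    {P' : Measure Ω'} [IsProbabilityMeasure P'] {φ : Ω' → Ω} (hX : B.IsThompsonSampling α P X)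
    (hφ : MeasurePreserving φ P' P) : B.IsThompsonSampling α P' (X.lift φ) := by
  have hH := B.measurable_history α hX.measurable_θstar hX.measurable_W hX.measurable_θ
  have hθ := hX.measurable_θstar
  refine ⟨hθ.comp hφ.measurable, fun t => (hX.measurable_W t).comp hφ.measurable,
    fun t => (hX.measurable_θ t).comp hφ.measurable, fun t => ?_, fun t => ?_, fun t => ?_,
    fun t => ?_⟩
  · rw [← hX.noise_law t, ← hφ.map_eq, Measure.map_map (hX.measurable_W t) hφ.measurable]
    rfl
  · exact (hX.noise_indep t).comp_measurePreserving hφ (hX.measurable_W t)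
      (hθ.prodMk ((hH t).prodMk (hX.measurable_θ t)))
  · filter_upwards [map_condExpKernel_comp_ae_eq hφ (hH t) (hX.measurable_θ t),
      map_condExpKernel_comp_ae_eq hφ (hH t) hθ,
      hφ.quasiMeasurePreserving.ae (hX.sample_law t)] with ω h1 h2 h3
    exact h1.trans (h3.trans h2.symm)
  · filter_upwards [map_condExpKernel_comp_ae_eq hφ (hH t) (hX.measurable_θ t),
      map_condExpKernel_comp_ae_eq hφ (hH t) hθ,
      map_condExpKernel_comp_ae_eq hφ (hH t) ((hX.measurable_θ t).prodMk hθ),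
      hφ.quasiMeasurePreserving.ae (hX.sample_indep t)] with ω h1 h2 h3 h4
    rw [indepFun_iff_map_prod_eq_prod_map_map (hX.measurable_θ t).aemeasurable hθ.aemeasurable] at h4
    refine (indepFun_iff_map_prod_eq_prod_map_map
      ((hX.measurable_θ t).comp hφ.measurable).aemeasurable
      (hθ.comp hφ.measurable).aemeasurable).2 ?_
    refine h3.trans (h4.trans ?_)
    rw [posterior, ← h1, ← h2]
    rfl

/-- If the target is a fresh draw of the true parameter given the history and the cell of the true
parameter, and the sample is that of Thompson sampling, the step is a compressed one. -/
theorem isCompressed_resample [Finite A] [MeasurableSpace.CountablyGenerated Y] {S : Type*}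
    [MeasurableSpace S] [StandardBorelSpace S] {U : Measure S} [IsProbabilityMeasure U]
    [Nonempty Θ] (hX : B.IsThompsonSampling α P X) {K : ℕ} {ψ : Ω → Fin K} {c : Θ → Fin K}
    (hc : ∀ ω, ψ ω = c (X.θstar ω)) {ε : ℝ}
    (hε : ∀ θ θ', c θ = c θ' → B.distortion α θ θ' ≤ ε) (t : ℕ)
    {f : Fin K × (Fin t → Θ × Y) → S → Θ} (hf : Measurable (Function.uncurry f))
    (hfq : ∀ x, U.map (f x) =
      condDistrib X.θstar (fun ω => (ψ ω, B.history α X t ω)) P x) :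
    B.IsCompressed α (P.prod U) (X.lift Prod.fst) (ψ ∘ Prod.fst) ε t
      (fun x => f (ψ x.1, B.history α X t x.1) x.2) (X.θ t ∘ Prod.fst) := by
  classical
  have : Fintype Θ := Fintype.ofFinite Θ
  have hφ : MeasurePreserving (Prod.fst : Ω × S → Ω) (P.prod U) P := measurePreserving_fst
  have hX' : B.IsThompsonSampling α (P.prod U) (X.lift Prod.fst) := hX.lift hφ
  have hH := B.measurable_history α hX.measurable_θstar hX.measurable_W hX.measurable_θ t
  have hθ := hX.measurable_θstar
  have hθt := hX.measurable_θ t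
  have hψ : Measurable ψ := by
    rw [show ψ = c ∘ X.θstar from funext hc]
    exact (measurable_of_finite c).comp hθ
  set q := condDistrib X.θstar (fun ω => (ψ ω, B.history α X t ω)) P with hq
  set τs : Ω × S → Θ := fun x => f (ψ x.1, B.history α X t x.1) x.2 with hτsdef
  have hτs : Measurable τs := by
    have : Measurable fun x : Ω × S => ((ψ x.1, B.history α X t x.1), x.2) := by fun_prop
    exact hf.comp this
  have hnoise : IndepFun ((X.lift (Prod.fst : Ω × S → Ω)).W t)
      (fun x => ((X.lift (Prod.fst : Ω × S → Ω)).θstar x,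
        B.history α (X.lift (Prod.fst : Ω × S → Ω)) t x, τs x, (X.θ t ∘ Prod.fst) x))
      (P.prod U) := by
    have h := (hX.noise_indep t).prodMk_snd (U := U) (hX.measurable_W t)
      (hθ.prodMk (hH.prodMk hθt))
    have hg : Measurable fun p : (Θ × (Fin t → Θ × Y) × Θ) × S =>
        (p.1.1, p.1.2.1, f (c p.1.1, p.1.2.1) p.2, p.1.2.2) := by
      have h1 : Measurable fun p : (Θ × (Fin t → Θ × Y) × Θ) × S =>
          ((c p.1.1, p.1.2.1), p.2) :=
        (((measurable_of_finite c).comp (by fun_prop)).prodMk (by fun_prop)).prodMk (by fun_prop)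
      have h2 := hf.comp h1
      exact (by fun_prop : Measurable fun p : (Θ × (Fin t → Θ × Y) × Θ) × S => p.1.1).prodMk
        ((by fun_prop : Measurable fun p : (Θ × (Fin t → Θ × Y) × Θ) × S => p.1.2.1).prodMk
          (h2.prodMk (by fun_prop)))
    have h3 := h.comp measurable_id hg
    simp only [hτsdef, hc]
    exact h3
  set κ' := B.posterior α (P.prod U) (X.lift (Prod.fst : Ω × S → Ω)) t with hκ'
  set κ := B.posterior α P X t with hκ
  -- The identity behind all the clauses: given the history and `ψ = k`, the target has law `q (k,
  -- ·)` and is independent of the pair of sample and true parameter.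
  have F0 : ∀ᵐ x ∂(P.prod U), ∀ (C : Set (Θ × Θ)) k a,
      κ' x (τs ⁻¹' {a} ∩ Prod.fst ⁻¹' ((fun ω => (X.θ t ω, X.θstar ω)) ⁻¹' C ∩ ψ ⁻¹' {k})) =
        q (k, B.history α X t x.1) {a} *
          κ x.1 ((fun ω => (X.θ t ω, X.θstar ω)) ⁻¹' C ∩ ψ ⁻¹' {k}) := by
    simp_rw [ae_all_iff]
    exact fun C k a => condExpKernel_resample_ae_eq hψ hH q hf hfq k a
      ((hθt.prodMk hθ) C.toFinite.measurableSet)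
  have F1 : ∀ᵐ x ∂(P.prod U), ∀ C : Set (Θ × Θ),
      κ' x (Prod.fst ⁻¹' ((fun ω => (X.θ t ω, X.θstar ω)) ⁻¹' C)) =
        κ x.1 ((fun ω => (X.θ t ω, X.θstar ω)) ⁻¹' C) := by
    rw [ae_all_iff]
    exact fun C => condExpKernel_preimage_ae_eq hφ hH ((hθt.prodMk hθ) C.toFinite.measurableSet)
  have F2 : ∀ᵐ x ∂(P.prod U), ∀ k a, κ x.1 (X.θstar ⁻¹' {a} ∩ ψ ⁻¹' {k}) =
      q (k, B.history α X t x.1) {a} * κ x.1 (ψ ⁻¹' {k}) := by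
    simp_rw [ae_all_iff]
    exact fun k a => hφ.quasiMeasurePreserving.ae
      (condDistrib_mul_condExpKernel_ae_eq hψ hH hθ k a)
  have F3 := hφ.quasiMeasurePreserving.ae (hX.sample_law t)
  have F4 := hφ.quasiMeasurePreserving.ae (hX.sample_indep t)
  have hθeq : ∀ θ, X.θstar ⁻¹' {θ} = X.θstar ⁻¹' {θ} ∩ ψ ⁻¹' {c θ} := fun θ => by
    ext ω
    simp only [Set.mem_preimage, Set.mem_singleton_iff, Set.mem_inter_iff, hc]
    exact ⟨fun h => ⟨h, by rw [h]⟩, fun h => h.1⟩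
  have hψC : ∀ k, ψ ⁻¹' {k} = (fun ω => (X.θ t ω, X.θstar ω)) ⁻¹' {p | c p.2 = k} := fun k => by
    ext ω; simp [hc]
  have F5 : ∀ᵐ x ∂(P.prod U), ∀ a θ, κ' x (τs ⁻¹' {a} ∩ Prod.fst ⁻¹' (X.θstar ⁻¹' {θ})) =
      q (c θ, B.history α X t x.1) {a} * κ x.1 (X.θstar ⁻¹' {θ}) := by
    filter_upwards [F0] with x h0 a θ
    have h := h0 {p | p.2 = θ} (c θ) a
    have e : (fun ω => (X.θ t ω, X.θstar ω)) ⁻¹' {p | p.2 = θ} = X.θstar ⁻¹' {θ} := rfl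
    rw [e, ← hθeq] at h
    exact h
  refine ⟨hτs, hθt.comp measurable_fst, hnoise, ?_, ?_, ?_, ?_, ?_⟩
  · filter_upwards [F0, F1] with x h0 h1 k
    have hk : MeasurableSet ((ψ ∘ Prod.fst : Ω × S → Fin K) ⁻¹' {k}) :=
      (hψ.comp measurable_fst) (measurableSet_singleton k)
    -- Conditioning on a null cell gives the zero measure, for which independence is trivial.
    by_cases hz : κ' x ((ψ ∘ Prod.fst : Ω × S → Fin K) ⁻¹' {k}) = 0
    · rw [cond_eq_zero_of_meas_eq_zero hz, indepFun_iff_measure_inter_preimage_eq_mul]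
      simp
    refine indepFun_of_forall_singleton hτs (hθ.comp measurable_fst) fun a θ => ?_
    rw [cond_apply hk, cond_apply hk, cond_apply hk]
    set z := κ' x ((ψ ∘ Prod.fst : Ω × S → Fin K) ⁻¹' {k}) with hzdef
    have hz' : z = κ x.1 (ψ ⁻¹' {k}) := by
      have h := h1 {p | c p.2 = k}
      rw [← hψC k] at h
      exact h
    have e1 : κ' x ((ψ ∘ Prod.fst : Ω × S → Fin K) ⁻¹' {k} ∩
        (τs ⁻¹' {a} ∩ (X.lift (Prod.fst : Ω × S → Ω)).θstar ⁻¹' {θ})) =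
        q (k, B.history α X t x.1) {a} * κ x.1 (X.θstar ⁻¹' {θ} ∩ ψ ⁻¹' {k}) := by
      refine Eq.trans (congrArg _ ?_) (h0 {p | p.2 = θ} k a)
      ext y; simp [Run.lift]; tauto
    have e2 : κ' x ((ψ ∘ Prod.fst : Ω × S → Fin K) ⁻¹' {k} ∩ τs ⁻¹' {a}) =
        q (k, B.history α X t x.1) {a} * z := by
      have h := h0 Set.univ k a
      rw [Set.preimage_univ, Set.univ_inter, ← hz', Set.inter_comm] at h
      exact h
    have e3 : κ' x ((ψ ∘ Prod.fst : Ω × S → Fin K) ⁻¹' {k} ∩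
        (X.lift (Prod.fst : Ω × S → Ω)).θstar ⁻¹' {θ}) =
        κ x.1 (X.θstar ⁻¹' {θ} ∩ ψ ⁻¹' {k}) := by
      have h := h1 ({p | p.2 = θ} ∩ {p | c p.2 = k})
      rw [Set.preimage_inter, ← hψC k] at h
      rw [Set.inter_comm]
      exact h
    change z⁻¹ * κ' x ((ψ ∘ Prod.fst : Ω × S → Fin K) ⁻¹' {k} ∩
        (τs ⁻¹' {a} ∩ (X.lift (Prod.fst : Ω × S → Ω)).θstar ⁻¹' {θ})) =
      z⁻¹ * κ' x ((ψ ∘ Prod.fst : Ω × S → Fin K) ⁻¹' {k} ∩ τs ⁻¹' {a}) *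
      (z⁻¹ * κ' x ((ψ ∘ Prod.fst : Ω × S → Fin K) ⁻¹' {k} ∩
        (X.lift (Prod.fst : Ω × S → Ω)).θstar ⁻¹' {θ}))
    rw [e1, e2, e3]
    have hinv : z⁻¹ * z = 1 := ENNReal.inv_mul_cancel hz (measure_ne_top _ _)
    calc _ = (z⁻¹ * z) * (z⁻¹ * (q (k, B.history α X t x.1) {a} *
          κ x.1 (X.θstar ⁻¹' {θ} ∩ ψ ⁻¹' {k}))) := by rw [hinv, one_mul]
      _ = _ := by ring
  -- The sample has the posterior law of `θstar`. So has the target: within each cell it is drawn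
  -- from the conditional law of `θstar`, and the cells are summed.
  · filter_upwards [F0, F1, F2, F3] with x h0 h1 h2 h3
    refine Measure.ext_of_singleton fun a => ?_
    rw [Measure.map_apply (hθt.comp measurable_fst) (measurableSet_singleton a),
      Measure.map_apply hτs (measurableSet_singleton a),
      measure_eq_sum_inter_preimage (hψ.comp measurable_fst) (hτs (measurableSet_singleton a))]
    have e1 := h1 {p | p.1 = a}
    have e2 := congrArg (fun μ => μ {a}) h3
    simp only [Measure.map_apply hθt (measurableSet_singleton a),
      Measure.map_apply hθ (measurableSet_singleton a)] at e2
    refine (e1.trans e2).trans ?_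
    rw [measure_eq_sum_inter_preimage hψ (hθ (measurableSet_singleton a))]
    refine Finset.sum_congr rfl fun k _ => ?_
    have e3 := h0 Set.univ k a
    rw [Set.preimage_univ, Set.univ_inter] at e3
    exact (h2 k a).trans e3.symm
  · filter_upwards [F0, F1, F5, F4] with x h0 h1 h5 h4
    refine indepFun_of_forall_singleton (hθt.comp measurable_fst)
      (hτs.prodMk (hθ.comp measurable_fst)) fun b p => ?_
    obtain ⟨a, θ⟩ := p
    have e1 := h0 {(b, θ)} (c θ) a
    have e2 : (fun ω => (X.θ t ω, X.θstar ω)) ⁻¹' {(b, θ)} ∩ ψ ⁻¹' {c θ} =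
        X.θ t ⁻¹' {b} ∩ X.θstar ⁻¹' {θ} := by
      rw [hθeq θ]; ext ω; simp; tauto
    have e3 : κ' x ((X.θ t ∘ Prod.fst : Ω × S → Θ) ⁻¹' {b}) = κ x.1 (X.θ t ⁻¹' {b}) :=
      h1 {p | p.1 = b}
    have e4 : (fun y : Ω × S => (τs y, (X.lift (Prod.fst : Ω × S → Ω)).θstar y)) ⁻¹' {(a, θ)} =
        τs ⁻¹' {a} ∩ Prod.fst ⁻¹' (X.θstar ⁻¹' {θ}) := by
      ext y; simp [Run.lift]
    have e5 : (X.θ t ∘ Prod.fst : Ω × S → Θ) ⁻¹' {b} ∩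
        (τs ⁻¹' {a} ∩ Prod.fst ⁻¹' (X.θstar ⁻¹' {θ})) =
        τs ⁻¹' {a} ∩ Prod.fst ⁻¹' (X.θ t ⁻¹' {b} ∩ X.θstar ⁻¹' {θ}) := by
      ext y; simp; tauto
    rw [e2] at e1
    have e6 := h4.measure_inter_preimage_eq_mul {b} {θ} (measurableSet_singleton b)
      (measurableSet_singleton θ)
    change κ' x _ = κ' x _ * κ' x _
    rw [e4, e5, e1, e3, h5 a θ]
    rw [show κ x.1 (X.θ t ⁻¹' {b} ∩ X.θstar ⁻¹' {θ}) =
      κ x.1 (X.θ t ⁻¹' {b}) * κ x.1 (X.θstar ⁻¹' {θ}) from e6]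
    ring
  · have hZ : Measurable fun x : Ω × S => (τs x, (X.lift (Prod.fst : Ω × S → Ω)).θstar x) :=
      hτs.prodMk (hθ.comp measurable_fst)
    have hN := ae_outcomesIndep hX' (t := t) hZ
      (hnoise.comp measurable_id (by fun_prop :
        Measurable fun p : Θ × (Fin t → Θ × Y) × Θ × Θ => ((p.2.2.1, p.1), p.2.1)))
    filter_upwards [hN, F5, F2] with x hx h5 h2
    have hW' := hX'.measurable_W t
    have hYs := B.measurable_outcome α hX'.measurable_θstar hW' hτs
    have hY := B.measurable_outcome α hX'.measurable_θstar hW' (hθt.comp measurable_fst)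
    have hbest := B.integrable_bestReward α (Q := κ' x) hX'.measurable_θstar
    have hYt : B.outcome α (X.lift (Prod.fst : Ω × S → Ω)) t
        ((X.lift (Prod.fst : Ω × S → Ω)).θ t) =
        B.outcome α (X.lift (Prod.fst : Ω × S → Ω)) t (X.θ t ∘ Prod.fst) := rfl
    rw [hYt]
    change ∫ x', _ ∂(κ' x) - ∫ x', _ ∂(κ' x) ≤ ε
    -- The reward of the sample occurs in both regrets and cancels; the rest is the mean distortion
    -- between target and true parameter.
    rw [integral_sub hbest (B.integrable_R_comp hY),
      integral_sub (B.integrable_R_comp hYs) (B.integrable_R_comp hY), sub_sub_sub_cancel_right]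
    set Z : Ω × S → Θ × Θ := fun x => (τs x, (X.lift (Prod.fst : Ω × S → Ω)).θstar x) with hZdef
    have i1 : ∫ y, B.R (B.outcome α (X.lift (Prod.fst : Ω × S → Ω)) t τs y) ∂(κ' x) =
        ∑ z, (κ' x).real (Z ⁻¹' {z}) * B.mean (α z.1) z.2 := by
      have h := OutcomesIndep.integral hW' hZ hx (fun _ => 1) (fun z => α z.1) (fun z => z.2)
      simp only [one_mul] at h
      exact h
    have hmapreal : ∀ z, ((κ' x).map Z).real {z} = (κ' x).real (Z ⁻¹' {z}) := fun z => by
      rw [measureReal_def, measureReal_def, Measure.map_apply hZ (measurableSet_singleton z)]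
    have i2 : ∫ y, B.bestReward α (X.lift (Prod.fst : Ω × S → Ω)) y ∂(κ' x) =
        ∑ z, (κ' x).real (Z ⁻¹' {z}) * B.mean (α z.2) z.2 := by
      have h := integral_map (μ := κ' x) hZ.aemeasurable
        (f := fun z : Θ × Θ => B.mean (α z.2) z.2)
        (measurable_of_finite _).aestronglyMeasurable
      have := Measure.isProbabilityMeasure_map (μ := κ' x) hZ.aemeasurable
      rw [integral_fintype (Integrable.of_finite)] at h
      simp only [hmapreal, smul_eq_mul] at h
      exact h.symm
    have hone : ∑ z, (κ' x).real (Z ⁻¹' {z}) = 1 := by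
      have := Measure.isProbabilityMeasure_map (μ := κ' x) hZ.aemeasurable
      have h := sum_measureReal_singleton (μ := (κ' x).map Z) Finset.univ
      simp only [Finset.coe_univ, probReal_univ, hmapreal] at h
      exact h
    rw [i1, i2, ← Finset.sum_sub_distrib]
    calc _ ≤ ∑ z, (κ' x).real (Z ⁻¹' {z}) * ε := Finset.sum_le_sum fun z _ => ?_
      _ = ε := by rw [← Finset.sum_mul, hone, one_mul]
    rw [← mul_sub]
    -- Pairs from one cell have distortion at most `ε`; pairs from different cells have posterior
    -- probability zero.
    by_cases hcz : c z.1 = c z.2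
    · exact mul_le_mul_of_nonneg_left (hε _ _ hcz) measureReal_nonneg
    · have hzero : κ' x (Z ⁻¹' {z}) = 0 := by
        have e : Z ⁻¹' {z} = τs ⁻¹' {z.1} ∩ Prod.fst ⁻¹' (X.θstar ⁻¹' {z.2}) := by
          ext y; simp [Z, Run.lift, Prod.ext_iff]
        rw [e, h5, mul_eq_zero]
        have h := h2 (c z.2) z.1
        have hempty : X.θstar ⁻¹' {z.1} ∩ ψ ⁻¹' {c z.2} = ∅ := by
          refine Set.eq_empty_of_forall_notMem fun ω hω => hcz ?_
          have h3 : X.θstar ω = z.1 := hω.1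
          have h4 : ψ ω = c z.2 := hω.2
          rw [← h3, ← hc, h4]
        rw [hempty, measure_empty] at h
        rcases mul_eq_zero.1 h.symm with h' | h'
        · exact Or.inl h'
        · refine Or.inr (measure_mono_null ?_ h')
          rw [hθeq]; exact Set.inter_subset_right
      rw [measureReal_def, hzero]; simp
  · exact ae_of_all _ fun x => le_rfl

end Bandit

/-! ### The theorem -/

theorem theorem1 {A Θ 𝒲 Y : Type*} [Finite A] [Finite Θ]
    [MeasurableSpace Θ] [MeasurableSingletonClass Θ] [MeasurableSpace 𝒲]
    [MeasurableSpace Y] [MeasurableSpace.CountablyGenerated Y]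
    (B : Bandit A Θ 𝒲 Y) (α : Θ → A) (hα : B.IsOptimal α)
    {K : ℕ} (cell : Fin K → Set Θ) (hcover : (⋃ k, cell k) = Set.univ)
    (hdisj : ∀ i j, i ≠ j → cell i ∩ cell j = ∅)
    (ε : ℝ) (hε : ∀ k, ∀ θ ∈ cell k, ∀ θ' ∈ cell k, B.distortion α θ θ' ≤ ε)
    {Ω : Type u} [MeasurableSpace Ω] [StandardBorelSpace Ω]
    (P : Measure Ω) [IsProbabilityMeasure P]
    (X : Run Θ 𝒲 Ω) (hX : B.IsThompsonSampling α P X)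
    (ψ : Ω → Fin K) (hψ : ∀ ω k, ψ ω = k ↔ X.θstar ω ∈ cell k) (T : ℕ) :
    -- compressed Thompson sampling exists, after enlarging the sample space if necessary
    (∃ (Ω' : Type u) (_ : MeasurableSpace Ω') (_ : StandardBorelSpace Ω')
        (P' : Measure Ω') (_ : IsProbabilityMeasure P') (φ : Ω' → Ω),
        MeasurePreserving φ P' P ∧ B.IsThompsonSampling α P' (X.lift φ) ∧
        ∃ τstar τ : ℕ → Ω' → Θ, ∀ t,
          B.IsCompressed α P' (X.lift φ) (ψ ∘ φ) ε t (τstar t) (τ t)) ∧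
    -- and every compressed Thompson sampling yields the regret bound
    (∀ τstar τ : ℕ → Ω → Θ,
        (∀ t < T, B.IsCompressed α P X ψ ε t (τstar t) (τ t)) →
        B.bayesRegret α P X T ≤
          Real.sqrt ((⨆ t : Fin T, B.infoRatio α P X t (τstar t) (τ t)) *
            (mutualInfo P X.θstar ψ).toReal * T) + ε * T) := by
  have hcell : ∀ θ, ∃ k, θ ∈ cell k := fun θ =>
    Set.mem_iUnion.1 (hcover ▸ Set.mem_univ θ)
  choose c hc using hcell
  have hψc : ∀ ω, ψ ω = c (X.θstar ω) := fun ω => (hψ ω _).2 (hc _)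
  refine ⟨?_, fun τstar τ h => Bandit.bayesRegret_le hX hψc T τstar τ h⟩
  have : Nonempty Θ := (nonempty_of_isProbabilityMeasure P).map X.θstar
  have hup : Measurable (ULift.up.{u} : unitInterval → ULift.{u} unitInterval) := measurable_up
  -- Uniform randomness, lifted so that the enlarged space stays in the universe of `Ω`.
  let U : Measure (ULift.{u} unitInterval) := (volume : Measure unitInterval).map ULift.up
  have : IsProbabilityMeasure U := Measure.isProbabilityMeasure_map hup.aemeasurable
  have hφ : MeasurePreserving (Prod.fst : Ω × ULift.{u} unitInterval → Ω) (P.prod U) P :=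
    measurePreserving_fst
  -- Each conditional law of `θstar` is realized as the image of the uniform law under a jointly
  -- measurable map. One uniform variable serves all periods, since each condition on a step
  -- concerns one period only.
  choose f hf hfq using fun t => Kernel.exists_measurable_map_eq_unitInterval
    (condDistrib X.θstar (fun ω => (ψ ω, B.history α X t ω)) P)
  refine ⟨Ω × ULift.{u} unitInterval, inferInstance, inferInstance, P.prod U, inferInstance,
    Prod.fst, hφ, hX.lift hφ, fun t x => f t (ψ x.1, B.history α X t x.1) x.2.down,
    fun t => X.θ t ∘ Prod.fst, fun t => ?_⟩
  refine Bandit.isCompressed_resample hX hψc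
    (fun θ θ' h => hε (c θ) θ (hc θ) θ' (h ▸ hc θ')) t (f := fun x (u : ULift.{u} unitInterval) => f t x u.down) ?_ ?_
  · have h : Measurable fun p : (Fin K × (Fin t → Θ × Y)) × ULift.{u} unitInterval =>
        (p.1, p.2.down) := measurable_fst.prodMk (measurable_down.comp measurable_snd)
    exact (hf t).comp h
  · intro x
    rw [← hfq t x]
    have h1 : Measurable (f t x) := (hf t).of_uncurry_left
    exact (Measure.map_map (h1.comp measurable_down) hup)
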